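/- Let $\mathbb E^4_1$ be $\mathbb R^4$ with the inner product $\langle v,w\rangle=-v_1w_1+v_2w_2+v_3w_3+v_4w_4$. Let $M$ be a smooth oriented surface (not necessarily connected) and $x:M\to\mathbb E^4_1$ a smooth space-like immersion, i.e. $\langle dx(v),dx(v)\rangle>0$ for every non-zero tangent vector $v$. Give $M$ the induced Riemannian metric, with Levi-Civita connection $\nabla$, Gaussian curvature $K$ and Laplace operator $\Delta=\sum_{i=1}^2(-e_ie_i+\nabla_{e_i}e_i)$, where $e_1,e_2$ is a local orthonormal frame. Let $h$ be the second fundamental form, $D$ the normal connection and $H=\frac12\operatorname{tr}h$ the mean curvature vector. Suppose that $M$ is marginally trapped: $H(p)\neq0$ and $\langle H(p),H(p)\rangle=0$ for every $p\in M$. Let $\nu=e_1\wedge e_2:M\to\Lambda^2(\mathbb E^4_1)$ be the Gauss map, where $e_1,e_2$ is any positively oriented local orthonormal frame. Call $M$ flat if $K\equiv0$, say that $H$ is parallel if $DH\equiv0$, and that the Gauss map is harmonic if $\Delta\nu\equiv0$. Say that $M$ has pointwise 1-type Gauss map of the first kind if $\Delta\nu=f\nu$ for some smooth function $f:M\to\mathbb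 R$; here $f\equiv0$, i.e. a harmonic Gauss map, is allowed. Then: 1. $M$ has pointwise 1-type Gauss map of the first kind if and only if $H$ is parallel. 2. If the function $f$ is moreover required not to vanish identically, the condition becomes: there is a smooth function $f\not\equiv0$ on $M$ with $\Delta\nu=f\nu$ if and only if $H$ is parallel and $M$ is not flat. 3. $M$ has harmonic Gauss map if and only if $M$ is flat and $H$ is parallel. -/

import Mathlib

open scoped Manifold ContDiff

noncomputable section

namespace MinkowskiSurface

/-- The parameter plane, the model space of a surface. -/
abbrev Plane : Type := EuclideanSpace ℝ (Fin 2)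

/-- The underlying real vector space of Minkowski space-time `𝔼⁴₁`. -/
abbrev Minkowski : Type := Fin 4 → ℝ

/-- The Lorentzian inner product of index one: `-v₁w₁ + v₂w₂ + v₃w₃ + v₄w₄`. -/
def mink (v w : Minkowski) : ℝ :=
  -(v 0 * w 0) + v 1 * w 1 + v 2 * w 2 + v 3 * w 3

/-- A light-like vector: non-zero, with vanishing Lorentzian square. -/
def IsLightlike (v : Minkowski) : Prop := v ≠ 0 ∧ mink v v = 0

/-! ### Riemannian geometry in a coordinate patch of the plane -/

/-- The `i`-th partial derivative of a map on the parameter plane. -/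
def pd {F : Type*} [NormedAddCommGroup F] [NormedSpace ℝ F]
    (i : Fin 2) (φ : Plane → F) (y : Plane) : F :=
  fderiv ℝ φ y (EuclideanSpace.single i 1)

/-- First fundamental form of a parametrization: `g_ij = ⟨∂ᵢX, ∂ⱼX⟩`. -/
def gram (X : Plane → Minkowski) (y : Plane) : Matrix (Fin 2) (Fin 2) ℝ :=
  Matrix.of fun i j => mink (pd i X y) (pd j X y)

/-- Christoffel symbols `Γᵏᵢⱼ` of the Levi-Civita connection of a metric `g`. -/
def christoffel (g : Plane → Matrix (Fin 2) (Fin 2) ℝ) (k i j : Fin 2) (y : Plane) : ℝ :=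
  (1 / 2) * ∑ l, (g y)⁻¹ k l *
    (pd i (fun z => g z j l) y + pd j (fun z => g z i l) y - pd l (fun z => g z i j) y)

/-- Components of the curvature tensor: `R(∂ᵢ, ∂ⱼ)∂ₖ = ∑ₗ Rˡ ∂ₗ`, with
`R(X, Y) = ∇_X ∇_Y - ∇_Y ∇_X - ∇_[X,Y]`. -/
def riemann (g : Plane → Matrix (Fin 2) (Fin 2) ℝ) (l i j k : Fin 2) (y : Plane) : ℝ :=
  pd i (christoffel g l j k) y - pd j (christoffel g l i k) y
    + ∑ m, (christoffel g l i m y * christoffel g m j k y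
        - christoffel g l j m y * christoffel g m i k y)

/-- Gaussian curvature `⟨R(∂₁, ∂₂)∂₂, ∂₁⟩ / det g`. -/
def gaussCurvCoord (g : Plane → Matrix (Fin 2) (Fin 2) ℝ) (y : Plane) : ℝ :=
  (∑ l, riemann g l 0 1 1 y * g y l 0) / (g y).det

/-- Covariant Hessian `∂ᵢ∂ⱼφ - ∑ₖ Γᵏᵢⱼ ∂ₖφ`. -/
def covHess {F : Type*} [NormedAddCommGroup F] [NormedSpace ℝ F]
    (g : Plane → Matrix (Fin 2) (Fin 2) ℝ) (φ : Plane → F) (i j : Fin 2) (y : Plane) : F :=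
  pd i (pd j φ) y - ∑ k, christoffel g k i j y • pd k φ y

/-! ### Surfaces in Minkowski space-time -/

section Surface

variable {M : Type*} [TopologicalSpace M] [ChartedSpace Plane M]

/-- A map on the surface, read in the preferred chart at `p`. At the parameter of `p` itself,
a coordinate formula evaluated on this map gives the value at `p` of the geometric object. -/
def inChart {F : Type*} (ψ : M → F) (p : M) : Plane → F :=
  ψ ∘ (extChartAt (𝓡 2) p).symm

/-- The parameter of `p` in the preferred chart at `p`. -/
def param (p : M) : Plane := extChartAt (𝓡 2) p p

/-- `x` is a smooth space-like immersion: every non-zero tangent vector is space-like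
(so the differential is injective). -/
structure IsSpacelikeImmersion (x : M → Minkowski) : Prop where
  smooth : ContMDiff (𝓡 2) 𝓘(ℝ, Minkowski) ∞ x
  spacelike : ∀ (p : M) (v : TangentSpace (𝓡 2) p), v ≠ 0 →
    0 < mink (mfderiv (𝓡 2) 𝓘(ℝ, Minkowski) x p v) (mfderiv (𝓡 2) 𝓘(ℝ, Minkowski) x p v)

/-- The induced metric at `p` in coordinates. -/
def metricAt (x : M → Minkowski) (p : M) : Matrix (Fin 2) (Fin 2) ℝ :=
  gram (inChart x p) (param p)

/-- The second fundamental form `h(∂ᵢ, ∂ⱼ)` at `p`, by the Gauss formula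
`∇̃_X Y = ∇_X Y + h(X, Y)`. -/
def secondForm (x : M → Minkowski) (p : M) (i j : Fin 2) : Minkowski :=
  covHess (gram (inChart x p)) (inChart x p) i j (param p)

/-- The mean curvature vector `H = (1/2) tr h`. -/
def meanCurvature (x : M → Minkowski) (p : M) : Minkowski :=
  (1 / 2 : ℝ) • ∑ i, ∑ j, (metricAt x p)⁻¹ i j • secondForm x p i j

/-- The Gaussian curvature of the induced metric. -/
def gaussCurvature (x : M → Minkowski) (p : M) : ℝ :=
  gaussCurvCoord (gram (inChart x p)) (param p)

/-- The surface is flat. -/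
def IsFlat (x : M → Minkowski) : Prop := ∀ p, gaussCurvature x p = 0

/-- The component of `w` normal to the surface at `p`. -/
def normalPart (x : M → Minkowski) (p : M) (w : Minkowski) : Minkowski :=
  w - ∑ i, ∑ j, ((metricAt x p)⁻¹ i j * mink w (pd i (inChart x p) (param p))) •
    pd j (inChart x p) (param p)

/-- The normal connection `D_v ξ`, by the Weingarten formula `∇̃_v ξ = -A_ξ v + D_v ξ`. -/
def normalDeriv (x ξ : M → Minkowski) (p : M) (v : TangentSpace (𝓡 2) p) : Minkowski :=
  normalPart x p (mfderiv (𝓡 2) 𝓘(ℝ, Minkowski) ξ p v)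

/-- The mean curvature vector is parallel in the normal bundle. -/
def HasParallelMeanCurvature (x : M → Minkowski) : Prop :=
  ∀ (p : M) (v : TangentSpace (𝓡 2) p), normalDeriv x (meanCurvature x) p v = 0

/-- A marginally trapped surface: space-like, with light-like (nowhere zero) mean curvature. -/
structure IsMarginallyTrapped (x : M → Minkowski) : Prop extends IsSpacelikeImmersion x where
  lightlike : ∀ p, IsLightlike (meanCurvature x p)

/-- The Laplace operator on functions,
`Δψ = ∑ᵢ (-eᵢeᵢψ + (∇_{eᵢ}eᵢ)ψ) = -∑ᵢⱼ gⁱʲ (∂ᵢ∂ⱼψ - ∑ₖ Γᵏᵢⱼ ∂ₖψ)`. -/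
def laplacian (x : M → Minkowski) (ψ : M → ℝ) (p : M) : ℝ :=
  -∑ i, ∑ j, (metricAt x p)⁻¹ i j *
    covHess (gram (inChart x p)) (inChart ψ p) i j (param p)

/-- The Laplace operator on maps into a finite-dimensional real vector space, applied to the
components in a basis (the result does not depend on the basis). -/
def vectorLaplacian {W : Type*} [AddCommGroup W] [Module ℝ W] [FiniteDimensional ℝ W]
    (x : M → Minkowski) (ψ : M → W) (p : M) : W :=
  ∑ a, laplacian x (fun q => (Module.finBasis ℝ W).repr (ψ q) a) p • Module.finBasis ℝ W a

/-! ### Orientation and the Gauss map -/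

/-- An orientation of the surface: an orientation of every tangent plane which is locally
constant in the local trivializations of the tangent bundle. -/
structure SurfaceOrientation (M : Type*) [TopologicalSpace M] [ChartedSpace Plane M]
    [IsManifold (𝓡 2) ∞ M] where
  orient : ∀ p : M, Orientation ℝ (TangentSpace (𝓡 2) p) (Fin 2)
  locallyConstant : ∀ p : M, IsLocallyConstant
    fun q : (trivializationAt Plane (TangentSpace (𝓡 2)) p).baseSet =>
      Orientation.map (Fin 2)
        ((trivializationAt Plane (TangentSpace (𝓡 2)) p).linearEquivAt ℝ q q.2) (orient q)

/-- The coordinate basis `(∂₁, ∂₂)` at `p` of the preferred chart at `p`. -/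
def coordBasis (p : M) : Module.Basis (Fin 2) ℝ (TangentSpace (𝓡 2) p) :=
  (EuclideanSpace.basisFun (Fin 2) ℝ).toBasis

open Classical in
/-- The Gauss map `ν = e₁ ∧ e₂ ∈ Λ²(𝔼⁴₁)`, where `(e₁, e₂)` is any positively oriented orthonormal
basis of the tangent plane; in coordinates, `ν = ± ∂₁x ∧ ∂₂x / √(det g)`, with the sign `+` when
`(∂₁, ∂₂)` is positively oriented. -/
def gaussMap [IsManifold (𝓡 2) ∞ M] (x : M → Minkowski) (o : SurfaceOrientation M) (p : M) :
    ⋀[ℝ]^2 Minkowski :=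
  ((if (coordBasis p).orientation = o.orient p then 1 else -1 : ℝ) /
      √(metricAt x p).det) •
    exteriorPower.ιMulti ℝ 2 ![pd 0 (inChart x p) (param p), pd 1 (inChart x p) (param p)]

/-- The Gauss map is harmonic: `Δν ≡ 0`. -/
def HasHarmonicGaussMap [IsManifold (𝓡 2) ∞ M] (x : M → Minkowski)
    (o : SurfaceOrientation M) : Prop :=
  ∀ p, vectorLaplacian x (gaussMap x o) p = 0

/-- The equation `Δν = f (ν + C)` for a function `f` and a constant bivector `C`. -/
def GaussMapEquation [IsManifold (𝓡 2) ∞ M] (x : M → Minkowski) (o : SurfaceOrientation M)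
    (f : M → ℝ) (C : ⋀[ℝ]^2 Minkowski) : Prop :=
  ∀ p, vectorLaplacian x (gaussMap x o) p = f p • (gaussMap x o p + C)

/-- Pointwise 1-type Gauss map of the first kind: `Δν = f (ν + C)` with `C = 0` and some smooth
function `f`, where `f ≡ 0` (a harmonic Gauss map) is allowed. -/
def HasPointwiseOneTypeFirstKind [IsManifold (𝓡 2) ∞ M] (x : M → Minkowski)
    (o : SurfaceOrientation M) : Prop :=
  ∃ f : M → ℝ, ContMDiff (𝓡 2) 𝓘(ℝ, ℝ) ∞ f ∧ GaussMapEquation x o f 0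

/-- Pointwise 1-type Gauss map of the first kind in the strict sense: `Δν = f (ν + C)` with
`C = 0` and some smooth function `f ≢ 0`. -/
def HasStrictPointwiseOneTypeFirstKind [IsManifold (𝓡 2) ∞ M] (x : M → Minkowski)
    (o : SurfaceOrientation M) : Prop :=
  ∃ f : M → ℝ, ContMDiff (𝓡 2) 𝓘(ℝ, ℝ) ∞ f ∧ f ≠ 0 ∧ GaussMapEquation x o f 0

end Surface

end MinkowskiSurface

end

/-! For an orthonormal frame, differentiating `e₁ ∧ e₂` twice with the Gauss and Weingarten formulas
and tracing with Codazzi gives Δν = (4⟨H,H⟩ - 2K) ν - 2 D_{e₁}H ∧ e₂ - 2 e₁ ∧ D_{e₂}H - 2 ∑ᵢ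
h(eᵢ,e₁) ∧ h(eᵢ,e₂). The four terms are tangential, mixed, mixed and normal bivectors, so Δν is a
multiple of ν exactly when the mixed part and the normal part vanish. The mixed part vanishes iff DH
= 0. As ⟨H,H⟩ = 0, the factor can only be f = -2K. Hence Δν = fν forces DH = 0 and f = -2K.

Conversely, if DH = 0, the Ricci equation says that the normal curvature annihilates H. The normal
plane is two-dimensional and H ≠ 0 there, so the whole normal curvature vanishes; by Ricci this is
the remaining normal part of Δν. Thus Δν = -2Kν, and all three claims follow: f ≢ 0 means not flat,
f ≡ 0 means flat.

The formula is `laplacianCoord_gaussCoord`, the two directions are `parallel_of_laplacianCoord` and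
`normalCurv_eq_zero`. Bivectors are handled by testing against alternating bilinear forms `B`, which
are the linear functionals on Λ². The geometric objects at a point are defined in the preferred
chart of that point, so derivatives on `M` need comparison of charts: `Reparam` supplies invariance,
and `eventually_orientSign` shows that the sign in the Gauss map causes no jumps. -/

namespace MinkowskiSurface

/-! ### Partial derivatives on the parameter plane -/

section PartialDerivatives

variable {E F G : Type*} [NormedAddCommGroup E] [NormedSpace ℝ E] [NormedAddCommGroup F]
  [NormedSpace ℝ F] [NormedAddCommGroup G] [NormedSpace ℝ G] {U : Set Plane} {y : Plane}

lemma pd_eventuallyEq {φ ψ : Plane → F} (h : φ =ᶠ[nhds y] ψ) (i : Fin 2) :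
    pd i φ =ᶠ[nhds y] pd i ψ := by
  filter_upwards [h.fderiv (𝕜 := ℝ)] with z hz
  simp [pd, hz]

lemma pd_congr {φ ψ : Plane → F} (hU : IsOpen U) (h : Set.EqOn φ ψ U) (hy : y ∈ U) (i : Fin 2) :
    pd i φ y = pd i ψ y :=
  (pd_eventuallyEq (h.eventuallyEq_of_mem (hU.mem_nhds hy)) i).eq_of_nhds

lemma contDiffOn_pd {φ : Plane → F} (hU : IsOpen U) (h : ContDiffOn ℝ ∞ φ U) (i : Fin 2) :
    ContDiffOn ℝ ∞ (pd i φ) U :=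
  (h.fderiv_of_isOpen hU (by simp)).clm_apply contDiffOn_const

lemma differentiableAt_of_contDiffOn {φ : Plane → F} (hU : IsOpen U) (h : ContDiffOn ℝ ∞ φ U)
    (hy : y ∈ U) : DifferentiableAt ℝ φ y :=
  (h.contDiffAt (hU.mem_nhds hy)).differentiableAt (by simp)

lemma pd_comm {φ : Plane → F} (hU : IsOpen U) (h : ContDiffOn ℝ ∞ φ U) (hy : y ∈ U)
    (i j : Fin 2) : pd i (pd j φ) y = pd j (pd i φ) y := by
  have hd : DifferentiableAt ℝ (fderiv ℝ φ) y :=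
    differentiableAt_of_contDiffOn hU (h.fderiv_of_isOpen hU (by simp)) hy
  have hs : IsSymmSndFDerivAt ℝ φ y :=
    (h.contDiffAt (hU.mem_nhds hy)).isSymmSndFDerivAt (by
      rw [minSmoothness_of_isRCLikeNormedField]
      exact WithTop.coe_le_coe.2 (le_top : (2 : ℕ∞) ≤ ⊤))
  have key : ∀ i j : Fin 2, pd i (pd j φ) y =
      fderiv ℝ (fderiv ℝ φ) y (EuclideanSpace.single i 1) (EuclideanSpace.single j 1) := by
    intro i j
    have := (hd.hasFDerivAt.clm_apply
      (hasFDerivAt_const (EuclideanSpace.single j (1 : ℝ)) y)).fderiv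
    unfold pd
    rw [this]
    simp
  rw [key, key, hs]

lemma pd_add {φ ψ : Plane → F} (hφ : DifferentiableAt ℝ φ y) (hψ : DifferentiableAt ℝ ψ y)
    (i : Fin 2) : pd i (fun z => φ z + ψ z) y = pd i φ y + pd i ψ y := by
  unfold pd
  rw [fderiv_fun_add hφ hψ]; rfl

lemma pd_sub {φ ψ : Plane → F} (hφ : DifferentiableAt ℝ φ y) (hψ : DifferentiableAt ℝ ψ y)
    (i : Fin 2) : pd i (fun z => φ z - ψ z) y = pd i φ y - pd i ψ y := by
  unfold pd
  rw [fderiv_fun_sub hφ hψ]; rfl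

lemma pd_sum {ι : Type*} (s : Finset ι) {φ : ι → Plane → F}
    (hφ : ∀ k ∈ s, DifferentiableAt ℝ (φ k) y) (i : Fin 2) :
    pd i (fun z => ∑ k ∈ s, φ k z) y = ∑ k ∈ s, pd i (φ k) y := by
  unfold pd
  rw [fderiv_fun_sum hφ]; simp

lemma pd_smul {c : Plane → ℝ} {ψ : Plane → F} (hc : DifferentiableAt ℝ c y)
    (hψ : DifferentiableAt ℝ ψ y) (i : Fin 2) :
    pd i (fun z => c z • ψ z) y = pd i c y • ψ y + c y • pd i ψ y := by
  unfold pd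
  rw [fderiv_fun_smul hc hψ]
  simp [add_comm]

lemma pd_mul {c d : Plane → ℝ} (hc : DifferentiableAt ℝ c y)
    (hd : DifferentiableAt ℝ d y) (i : Fin 2) :
    pd i (fun z => c z * d z) y = pd i c y * d y + c y * pd i d y :=
  pd_smul hc hd i

lemma pd_const_smul (c : ℝ) {ψ : Plane → F} (hψ : DifferentiableAt ℝ ψ y) (i : Fin 2) :
    pd i (fun z => c • ψ z) y = c • pd i ψ y := by
  unfold pd
  rw [fderiv_fun_const_smul hψ]; rfl

lemma pd_const (c : F) (i : Fin 2) : pd i (fun _ => c) y = 0 := by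
  simp [pd]

lemma contDiffOn_bilin [FiniteDimensional ℝ E] [FiniteDimensional ℝ F] (B : E →ₗ[ℝ] F →ₗ[ℝ] G)
    {φ : Plane → E} {ψ : Plane → F} (hφ : ContDiffOn ℝ ∞ φ U) (hψ : ContDiffOn ℝ ∞ ψ U) :
    ContDiffOn ℝ ∞ (fun z => B (φ z) (ψ z)) U :=
  (B.toContinuousBilinearMap.contDiff.comp_contDiffOn hφ).clm_apply hψ

lemma pd_bilin [FiniteDimensional ℝ E] [FiniteDimensional ℝ F] (B : E →ₗ[ℝ] F →ₗ[ℝ] G)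
    {φ : Plane → E} {ψ : Plane → F} (hφ : DifferentiableAt ℝ φ y) (hψ : DifferentiableAt ℝ ψ y)
    (i : Fin 2) :
    pd i (fun z => B (φ z) (ψ z)) y = B (pd i φ y) (ψ y) + B (φ y) (pd i ψ y) := by
  have := (B.toContinuousBilinearMap.hasFDerivAt_of_bilinear hφ.hasFDerivAt hψ.hasFDerivAt).fderiv
  unfold pd
  refine (DFunLike.congr_fun this _).trans ?_
  simp [add_comm]

lemma fderiv_plane_apply (φ : Plane → F) (y v : Plane) :
    fderiv ℝ φ y v = ∑ i, v i • pd i φ y := by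
  have hv : v = ∑ i, v i • EuclideanSpace.single i (1 : ℝ) := by
    ext k; fin_cases k <;> simp
  conv_lhs => rw [hv]
  simp [pd]

/-- The chain rule for partial derivatives. -/
lemma pd_comp {φ : Plane → F} {τ : Plane → Plane} (hφ : DifferentiableAt ℝ φ (τ y))
    (hτ : DifferentiableAt ℝ τ y) (i : Fin 2) :
    pd i (fun z => φ (τ z)) y = ∑ a, pd i τ y a • pd a φ (τ y) := by
  have h := (hφ.hasFDerivAt.comp y hτ.hasFDerivAt).fderiv
  refine (DFunLike.congr_fun h _).trans ?_
  exact fderiv_plane_apply φ (τ y) _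

end PartialDerivatives

/-! ### The Lorentzian inner product as a bilinear form -/

/-- The Lorentzian inner product, bundled as a bilinear map. -/
def minkBilin : Minkowski →ₗ[ℝ] Minkowski →ₗ[ℝ] ℝ :=
  LinearMap.mk₂ ℝ mink
    (by intros; simp only [mink, Pi.add_apply]; ring)
    (by intros; simp only [mink, Pi.smul_apply, smul_eq_mul]; ring)
    (by intros; simp only [mink, Pi.add_apply]; ring)
    (by intros; simp only [mink, Pi.smul_apply, smul_eq_mul]; ring)

lemma minkBilin_apply (v w : Minkowski) : minkBilin v w = mink v w := rfl

lemma mink_comm (v w : Minkowski) : mink v w = mink w v := by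
  simp only [mink]; ring

lemma mink_add_left (u v w : Minkowski) : mink (u + v) w = mink u w + mink v w := by
  simp only [mink, Pi.add_apply]; ring

lemma mink_sub_left (u v w : Minkowski) : mink (u - v) w = mink u w - mink v w := by
  simp only [mink, Pi.sub_apply]; ring

lemma mink_smul_left (c : ℝ) (v w : Minkowski) : mink (c • v) w = c * mink v w := by
  simp only [mink, Pi.smul_apply, smul_eq_mul]; ring

lemma mink_add_right (u v w : Minkowski) : mink u (v + w) = mink u v + mink u w := by
  simp only [mink, Pi.add_apply]; ring

lemma mink_smul_right (c : ℝ) (v w : Minkowski) : mink v (c • w) = c * mink v w := by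
  simp only [mink, Pi.smul_apply, smul_eq_mul]; ring

lemma mink_zero_left (w : Minkowski) : mink 0 w = 0 := by simp [mink]

lemma mink_sum_left {ι : Type*} (s : Finset ι) (f : ι → Minkowski) (w : Minkowski) :
    mink (∑ k ∈ s, f k) w = ∑ k ∈ s, mink (f k) w := by
  simp [← minkBilin_apply]

/-- The Lorentzian inner product is non-degenerate. -/
lemma eq_zero_of_forall_mink_eq_zero {v : Minkowski} (h : ∀ w, mink v w = 0) : v = 0 := by
  ext k
  have := h (Pi.single k 1)
  fin_cases k <;> simpa [mink, Pi.single_apply] using this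

/-! ### Regular space-like patches -/

/-- A smooth map on an open subset of the parameter plane, with first fundamental form of positive
determinant. -/
structure RegularPatch (X : Plane → Minkowski) (U : Set Plane) : Prop where
  isOpen : IsOpen U
  smooth : ContDiffOn ℝ ∞ X U
  det_pos : ∀ y ∈ U, 0 < (gram X y).det

/-- The component of `w` normal to the patch `X`. -/
noncomputable def proj (X : Plane → Minkowski) (y : Plane) (w : Minkowski) : Minkowski :=
  w - ∑ i, ∑ j, ((gram X y)⁻¹ i j * mink w (pd i X y)) • pd j X y

/-- The mean curvature vector of a patch. -/
noncomputable def meanCoord (X : Plane → Minkowski) (y : Plane) : Minkowski :=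
  (1 / 2 : ℝ) • ∑ i, ∑ j, (gram X y)⁻¹ i j • covHess (gram X) X i j y

/-- The covariant derivative `(∇_∂ⱼ h)(∂ᵢ, ∂ₖ)` of the second fundamental form. -/
noncomputable def covDerivForm (X : Plane → Minkowski) (j i k : Fin 2) (y : Plane) : Minkowski :=
  proj X y (pd j (pd i (pd k X)) y)
    - ∑ m, (christoffel (gram X) m i k y • covHess (gram X) X j m y
      + christoffel (gram X) m j i y • covHess (gram X) X m k y
      + christoffel (gram X) m j k y • covHess (gram X) X i m y)

lemma gram_apply (X : Plane → Minkowski) (y : Plane) (i j : Fin 2) :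
    gram X y i j = mink (pd i X y) (pd j X y) := rfl

lemma gram_comm (X : Plane → Minkowski) (y : Plane) (i j : Fin 2) :
    gram X y i j = gram X y j i := mink_comm _ _

lemma inv_apply_two (g : Matrix (Fin 2) (Fin 2) ℝ) :
    g⁻¹ 0 0 = g 1 1 / g.det ∧ g⁻¹ 0 1 = -g 0 1 / g.det ∧ g⁻¹ 1 0 = -g 1 0 / g.det ∧
      g⁻¹ 1 1 = g 0 0 / g.det := by
  rw [Matrix.inv_def, Matrix.adjugate_fin_two, Ring.inverse_eq_inv']
  refine ⟨?_, ?_, ?_, ?_⟩ <;> simp <;> ring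

lemma gram_inv_comm (X : Plane → Minkowski) (y : Plane) (i j : Fin 2) :
    (gram X y)⁻¹ i j = (gram X y)⁻¹ j i := by
  obtain ⟨h00, h01, h10, h11⟩ := inv_apply_two (gram X y)
  fin_cases i <;> fin_cases j <;> simp [h01, h10, gram_comm X y 0 1]

namespace RegularPatch

variable {X : Plane → Minkowski} {U : Set Plane} {y : Plane}

lemma mono (h : RegularPatch X U) {V : Set Plane} (hV : IsOpen V) (hVU : V ⊆ U) :
    RegularPatch X V :=
  ⟨hV, h.smooth.mono hVU, fun y hy => h.det_pos y (hVU hy)⟩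

lemma det_ne (h : RegularPatch X U) (hy : y ∈ U) : (gram X y).det ≠ 0 := (h.det_pos y hy).ne'

lemma smooth_pd (h : RegularPatch X U) (i : Fin 2) : ContDiffOn ℝ ∞ (pd i X) U :=
  contDiffOn_pd h.isOpen h.smooth i

lemma smooth_pd_pd (h : RegularPatch X U) (i j : Fin 2) : ContDiffOn ℝ ∞ (pd i (pd j X)) U :=
  contDiffOn_pd h.isOpen (h.smooth_pd j) i

lemma differentiableAt {F : Type*} [NormedAddCommGroup F] [NormedSpace ℝ F]
    (h : RegularPatch X U) {φ : Plane → F} (hφ : ContDiffOn ℝ ∞ φ U) (hy : y ∈ U) :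
    DifferentiableAt ℝ φ y :=
  differentiableAt_of_contDiffOn h.isOpen hφ hy

lemma smooth_mink {φ ψ : Plane → Minkowski} (hφ : ContDiffOn ℝ ∞ φ U)
    (hψ : ContDiffOn ℝ ∞ ψ U) : ContDiffOn ℝ ∞ (fun z => mink (φ z) (ψ z)) U :=
  contDiffOn_bilin minkBilin hφ hψ

lemma smooth_gram (h : RegularPatch X U) (i j : Fin 2) :
    ContDiffOn ℝ ∞ (fun z => gram X z i j) U :=
  smooth_mink (h.smooth_pd i) (h.smooth_pd j)

lemma smooth_det (h : RegularPatch X U) : ContDiffOn ℝ ∞ (fun z => (gram X z).det) U := by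
  simp only [Matrix.det_fin_two]
  exact ((h.smooth_gram 0 0).mul (h.smooth_gram 1 1)).sub
    ((h.smooth_gram 0 1).mul (h.smooth_gram 1 0))

lemma smooth_inv (h : RegularPatch X U) (i j : Fin 2) :
    ContDiffOn ℝ ∞ (fun z => (gram X z)⁻¹ i j) U := by
  have e := fun z => inv_apply_two (gram X z)
  have hd := h.smooth_det
  have hne : ∀ z ∈ U, (gram X z).det ≠ 0 := fun z hz => h.det_ne hz
  fin_cases i <;> fin_cases j
  · exact ((h.smooth_gram 1 1).div hd hne).congr fun z _ => (e z).1
  · exact ((h.smooth_gram 0 1).neg.div hd hne).congr fun z _ => (e z).2.1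
  · exact ((h.smooth_gram 1 0).neg.div hd hne).congr fun z _ => (e z).2.2.1
  · exact ((h.smooth_gram 0 0).div hd hne).congr fun z _ => (e z).2.2.2

lemma pd_gram (h : RegularPatch X U) (hy : y ∈ U) (k i j : Fin 2) :
    pd k (fun z => gram X z i j) y =
      mink (pd k (pd i X) y) (pd j X y) + mink (pd i X y) (pd k (pd j X) y) :=
  pd_bilin minkBilin (h.differentiableAt (h.smooth_pd i) hy)
    (h.differentiableAt (h.smooth_pd j) hy) k

lemma pd_comm (h : RegularPatch X U) (hy : y ∈ U) (i j : Fin 2) :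
    pd i (pd j X) y = pd j (pd i X) y :=
  MinkowskiSurface.pd_comm h.isOpen h.smooth hy i j

lemma inv_mul_gram (h : RegularPatch X U) (hy : y ∈ U) (i k : Fin 2) :
    ∑ j, (gram X y)⁻¹ i j * gram X y j k = if i = k then 1 else 0 := by
  have := Matrix.nonsing_inv_mul (gram X y) (isUnit_iff_ne_zero.mpr (h.det_ne hy))
  rw [← Matrix.mul_apply, this, Matrix.one_apply]

/-- For an induced metric the three derivatives in the Koszul formula collapse, by symmetry of
second derivatives, to twice one inner product. -/
lemma christoffel_eq (h : RegularPatch X U) (hy : y ∈ U) (k i j : Fin 2) :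
    christoffel (gram X) k i j y =
      ∑ l, (gram X y)⁻¹ k l * mink (pd i (pd j X) y) (pd l X y) := by
  unfold christoffel
  rw [Finset.mul_sum]
  refine Finset.sum_congr rfl fun l _ => ?_
  rw [h.pd_gram hy, h.pd_gram hy, h.pd_gram hy, h.pd_comm hy l i, h.pd_comm hy l j,
    h.pd_comm hy j i, mink_comm (pd j X y), mink_comm (pd i X y)]
  ring

lemma christoffel_comm (h : RegularPatch X U) (hy : y ∈ U) (k i j : Fin 2) :
    christoffel (gram X) k i j y = christoffel (gram X) k j i y := by
  simp only [h.christoffel_eq hy, h.pd_comm hy i j]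

lemma covHess_comm (h : RegularPatch X U) (hy : y ∈ U) (i j : Fin 2) :
    covHess (gram X) X i j y = covHess (gram X) X j i y := by
  simp only [covHess, h.pd_comm hy i j, fun k => h.christoffel_comm hy k i j]

lemma smooth_christoffel (h : RegularPatch X U) (k i j : Fin 2) :
    ContDiffOn ℝ ∞ (christoffel (gram X) k i j) U := by
  have : ContDiffOn ℝ ∞ (fun z => ∑ l, (gram X z)⁻¹ k l * mink (pd i (pd j X) z) (pd l X z)) U :=
    ContDiffOn.sum fun l _ => (h.smooth_inv k l).mul (smooth_mink (h.smooth_pd_pd i j) (h.smooth_pd l))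
  exact this.congr fun z hz => h.christoffel_eq hz k i j

lemma smooth_covHess (h : RegularPatch X U) (i j : Fin 2) :
    ContDiffOn ℝ ∞ (covHess (gram X) X i j) U :=
  (h.smooth_pd_pd i j).sub
    (ContDiffOn.sum fun k _ => (h.smooth_christoffel k i j).smul (h.smooth_pd k))

lemma smooth_meanCoord (h : RegularPatch X U) : ContDiffOn ℝ ∞ (meanCoord X) U :=
  ContDiffOn.const_smul _ (ContDiffOn.sum fun i _ => ContDiffOn.sum fun j _ =>
    (h.smooth_inv i j).smul (h.smooth_covHess i j))

/-- The Gauss formula. -/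
lemma pd_pd_eq (X : Plane → Minkowski) (y : Plane) (i j : Fin 2) :
    pd i (pd j X) y =
      covHess (gram X) X i j y + ∑ k, christoffel (gram X) k i j y • pd k X y := by
  simp [covHess]

lemma sum_inv_mul_gram_mul (h : RegularPatch X U) (hy : y ∈ U) (c : Fin 2 → ℝ) (l : Fin 2) :
    ∑ k, (∑ m, (gram X y)⁻¹ k m * c m) * gram X y k l = c l := by
  have e : ∀ m, ∑ k, (gram X y)⁻¹ m k * gram X y k l = if m = l then 1 else 0 :=
    fun m => h.inv_mul_gram hy m l
  have e0 := e 0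
  have e1 := e 1
  simp only [Fin.sum_univ_two] at e0 e1 ⊢
  rw [gram_inv_comm X y 0 1] at *
  fin_cases l <;> simp at e0 e1 ⊢ <;>
    linear_combination (c 0) * e0 + (c 1) * e1

lemma christoffel_mul_gram (h : RegularPatch X U) (hy : y ∈ U) (i j l : Fin 2) :
    ∑ k, christoffel (gram X) k i j y * gram X y k l = mink (pd i (pd j X) y) (pd l X y) := by
  simp only [h.christoffel_eq hy]
  exact h.sum_inv_mul_gram_mul hy (fun m => mink (pd i (pd j X) y) (pd m X y)) l

/-- The Christoffel symbols are exactly the tangential coefficients of the second derivatives, so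
what remains after subtracting them is normal. -/
lemma mink_covHess_pd (h : RegularPatch X U) (hy : y ∈ U) (i j l : Fin 2) :
    mink (covHess (gram X) X i j y) (pd l X y) = 0 := by
  rw [covHess, mink_sub_left, mink_sum_left]
  simp only [mink_smul_left, ← gram_apply, h.christoffel_mul_gram hy, sub_self]

/-! #### The normal projection -/

lemma proj_add (v w : Minkowski) : proj X y (v + w) = proj X y v + proj X y w := by
  simp only [proj, Fin.sum_univ_two, mink_add_left]
  module

lemma proj_sub (v w : Minkowski) : proj X y (v - w) = proj X y v - proj X y w := by
  simp only [proj, Fin.sum_univ_two, mink_sub_left]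
  module

lemma proj_smul (c : ℝ) (w : Minkowski) : proj X y (c • w) = c • proj X y w := by
  simp only [proj, Fin.sum_univ_two, mink_smul_left]
  module

lemma proj_zero : proj X y 0 = 0 := by simp [proj, mink_zero_left]

lemma proj_sum {ι : Type*} (s : Finset ι) (f : ι → Minkowski) :
    proj X y (∑ k ∈ s, f k) = ∑ k ∈ s, proj X y (f k) := by
  classical
  induction s using Finset.induction_on with
  | empty => simp [proj_zero]
  | insert a s ha ih => rw [Finset.sum_insert ha, Finset.sum_insert ha, proj_add, ih]

lemma proj_of_normal {w : Minkowski} (hw : ∀ k, mink w (pd k X y) = 0) : proj X y w = w := by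
  simp [proj, hw]

lemma proj_covHess (h : RegularPatch X U) (hy : y ∈ U) (i j : Fin 2) :
    proj X y (covHess (gram X) X i j y) = covHess (gram X) X i j y :=
  proj_of_normal fun k => h.mink_covHess_pd hy i j k

lemma proj_pd (h : RegularPatch X U) (hy : y ∈ U) (k : Fin 2) : proj X y (pd k X y) = 0 := by
  rw [proj, sub_eq_zero, Finset.sum_comm]
  simp only [← Finset.sum_smul, ← gram_apply]
  have e : ∀ j, ∑ i, (gram X y)⁻¹ i j * gram X y k i = if j = k then 1 else 0 := by
    intro j
    rw [← h.inv_mul_gram hy j k]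
    exact Finset.sum_congr rfl fun i _ => by rw [gram_inv_comm X y i j, gram_comm X y k i]
  simp [e]

lemma mink_proj_pd (h : RegularPatch X U) (hy : y ∈ U) (w : Minkowski) (l : Fin 2) :
    mink (proj X y w) (pd l X y) = 0 := by
  rw [proj, mink_sub_left, Finset.sum_comm]
  simp only [← Finset.sum_smul, mink_sum_left, mink_smul_left, ← gram_apply]
  have := h.sum_inv_mul_gram_mul hy (fun m => mink w (pd m X y)) l
  simp only [gram_inv_comm X y _] at this ⊢
  rw [sub_eq_zero, ← this]

lemma eq_proj_add (w : Minkowski) :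
    w = proj X y w + ∑ i, ∑ j, ((gram X y)⁻¹ i j * mink w (pd i X y)) • pd j X y := by
  simp [proj]

end RegularPatch

namespace RegularPatch

variable {X : Plane → Minkowski} {U : Set Plane} {y : Plane}

/-! #### The structure equations -/

lemma proj_pd_pd (h : RegularPatch X U) (hy : y ∈ U) (i j : Fin 2) :
    proj X y (pd i (pd j X) y) = covHess (gram X) X i j y := by
  rw [pd_pd_eq, proj_add, proj_sum, h.proj_covHess hy]
  simp [proj_smul, h.proj_pd hy]

/-- Two vectors normal to a patch pair with a tangential derivative through the second
fundamental form. -/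
lemma mink_normal_pd_pd (y : Plane) {w : Minkowski}
    (hw : ∀ k, mink w (pd k X y) = 0) (i j : Fin 2) :
    mink w (pd i (pd j X) y) = mink w (covHess (gram X) X i j y) := by
  rw [pd_pd_eq, Fin.sum_univ_two, mink_add_right, mink_add_right, mink_smul_right,
    mink_smul_right, hw, hw]
  simp

/-- The Weingarten formula for a normal field. -/
lemma mink_pd_normal (h : RegularPatch X U) (hy : y ∈ U) {ξ : Plane → Minkowski}
    (hξ : ContDiffOn ℝ ∞ ξ U) (hn : ∀ z ∈ U, ∀ k, mink (ξ z) (pd k X z) = 0) (j l : Fin 2) :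
    mink (pd j ξ y) (pd l X y) = -mink (ξ y) (covHess (gram X) X j l y) := by
  have h1 : pd j (fun z => mink (ξ z) (pd l X z)) y = 0 := by
    rw [pd_congr h.isOpen (ψ := fun _ => (0 : ℝ)) (fun z hz => hn z hz l) hy, pd_const]
  have h2 := pd_bilin minkBilin (h.differentiableAt hξ hy)
    (h.differentiableAt (h.smooth_pd l) hy) j
  simp only [minkBilin_apply] at h2
  rw [h1, mink_normal_pd_pd y (hn y hy)] at h2
  linarith

lemma pd_sum_christoffel (h : RegularPatch X U) (hy : y ∈ U) (j i k : Fin 2) :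
    pd j (fun z => ∑ m, christoffel (gram X) m i k z • pd m X z) y =
      ∑ m, (pd j (christoffel (gram X) m i k) y • pd m X y +
        christoffel (gram X) m i k y • pd j (pd m X) y) := by
  rw [pd_sum]
  · exact Finset.sum_congr rfl fun m _ => pd_smul
      (h.differentiableAt (h.smooth_christoffel m i k) hy) (h.differentiableAt (h.smooth_pd m) hy) j
  · intro m _
    exact (h.differentiableAt (h.smooth_christoffel m i k) hy).smul
      (h.differentiableAt (h.smooth_pd m) hy)

lemma pd_covHess_eq (h : RegularPatch X U) (hy : y ∈ U) (j i k : Fin 2) :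
    pd j (covHess (gram X) X i k) y = pd j (pd i (pd k X)) y -
      ∑ m, (pd j (christoffel (gram X) m i k) y • pd m X y +
        christoffel (gram X) m i k y • pd j (pd m X) y) := by
  rw [← h.pd_sum_christoffel hy]
  refine pd_sub (h.differentiableAt (h.smooth_pd_pd i k) hy) ?_ j
  exact h.differentiableAt (ContDiffOn.sum fun m _ =>
    (h.smooth_christoffel m i k).smul (h.smooth_pd m)) hy

/-- Differentiating the Gauss formula, the terms with derivatives of Christoffel symbols are
tangential and disappear under the projection. -/
lemma proj_pd_covHess (h : RegularPatch X U) (hy : y ∈ U) (j i k : Fin 2) :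
    proj X y (pd j (covHess (gram X) X i k) y) = covDerivForm X j i k y +
      ∑ m, (christoffel (gram X) m j i y • covHess (gram X) X m k y
        + christoffel (gram X) m j k y • covHess (gram X) X i m y) := by
  rw [h.pd_covHess_eq hy, proj_sub, proj_sum, covDerivForm]
  simp only [proj_add, proj_smul, h.proj_pd hy, h.proj_pd_pd hy, smul_zero, zero_add,
    Finset.sum_add_distrib]
  module

/-- The normal part comes from `proj_pd_covHess`, the tangential part from the Weingarten formula;
the latter is the source of the ‖h‖² term in the Laplacian of the Gauss map. -/
lemma pd_covHess_decomp (h : RegularPatch X U) (hy : y ∈ U) (j i k : Fin 2) :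
    pd j (covHess (gram X) X i k) y = covDerivForm X j i k y +
      ∑ m, (christoffel (gram X) m j i y • covHess (gram X) X m k y
        + christoffel (gram X) m j k y • covHess (gram X) X i m y) -
      ∑ l, ∑ m, ((gram X y)⁻¹ l m * mink (covHess (gram X) X i k y)
        (covHess (gram X) X j l y)) • pd m X y := by
  conv_lhs => rw [eq_proj_add (X := X) (y := y) (pd j (covHess (gram X) X i k) y)]
  rw [h.proj_pd_covHess hy]
  simp only [h.mink_pd_normal hy (h.smooth_covHess i k) (fun z hz l => h.mink_covHess_pd hz i k l)]
  simp only [Fin.sum_univ_two]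
  module

/-- The Codazzi equation. -/
lemma covDerivForm_comm (h : RegularPatch X U) (hy : y ∈ U) (j i k : Fin 2) :
    covDerivForm X j i k y = covDerivForm X i j k y := by
  have e : pd j (pd i (pd k X)) y = pd i (pd j (pd k X)) y :=
    MinkowskiSurface.pd_comm h.isOpen (h.smooth_pd k) hy j i
  simp only [covDerivForm, e, Fin.sum_univ_two, h.christoffel_comm hy _ i j,
    h.covHess_comm hy i]
  module

lemma covDerivForm_comm_right (h : RegularPatch X U) (hy : y ∈ U) (j i k : Fin 2) :
    covDerivForm X j i k y = covDerivForm X j k i y := by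
  have e : pd j (pd i (pd k X)) y = pd j (pd k (pd i X)) y :=
    pd_congr h.isOpen (fun z hz => h.pd_comm hz i k) hy j
  simp only [covDerivForm, e, Fin.sum_univ_two, h.christoffel_comm hy _ i k,
    h.covHess_comm hy i]
  rw [h.covHess_comm hy 0 k, h.covHess_comm hy 1 k]
  module

/-- The derivative of the inverse metric. -/
lemma pd_inv (h : RegularPatch X U) (hy : y ∈ U) (j i k : Fin 2) :
    pd j (fun z => (gram X z)⁻¹ i k) y =
      -∑ m, (christoffel (gram X) i j m y * (gram X y)⁻¹ m k
        + christoffel (gram X) k j m y * (gram X y)⁻¹ i m) := by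
  have hinv : ∀ a b, DifferentiableAt ℝ (fun z => (gram X z)⁻¹ a b) y :=
    fun a b => h.differentiableAt (h.smooth_inv a b) hy
  have hgram : ∀ a b, DifferentiableAt ℝ (fun z => gram X z a b) y :=
    fun a b => h.differentiableAt (h.smooth_gram a b) hy
  have hpg : ∀ a b, pd j (fun z => gram X z a b) y =
      ∑ m, (christoffel (gram X) m j a y * gram X y m b
        + christoffel (gram X) m j b y * gram X y m a) := by
    intro a b
    rw [h.pd_gram hy, mink_comm (pd a X y), ← h.christoffel_mul_gram hy,
      ← h.christoffel_mul_gram hy, Finset.sum_add_distrib]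
  -- Differentiation of the constant matrix g⁻¹g.
  have key : ∀ c, ∑ a, pd j (fun z => (gram X z)⁻¹ i a) y * gram X y a c =
      -∑ a, (gram X y)⁻¹ i a * pd j (fun z => gram X z a c) y := by
    intro c
    have h1 : pd j (fun z => ∑ a, (gram X z)⁻¹ i a * gram X z a c) y = 0 := by
      rw [pd_congr h.isOpen (ψ := fun _ => if i = c then (1 : ℝ) else 0)
        (fun z hz => h.inv_mul_gram hz i c) hy, pd_const]
    rw [pd_sum Finset.univ (φ := fun a z => (gram X z)⁻¹ i a * gram X z a c)
      fun a _ => (hinv i a).mul (hgram a c)] at h1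
    simp only [pd_mul (hinv i _) (hgram _ c), Finset.sum_add_distrib] at h1
    linarith
  have hr : ∀ a b, ∑ c, gram X y a c * (gram X y)⁻¹ c b = if a = b then 1 else 0 := by
    intro a b
    rw [← h.inv_mul_gram hy a b]
    have := Matrix.mul_nonsing_inv (gram X y) (isUnit_iff_ne_zero.mpr (h.det_ne hy))
    rw [← Matrix.mul_apply, this, h.inv_mul_gram hy, Matrix.one_apply]
  have hl : ∀ a b, ∑ c, (gram X y)⁻¹ a c * gram X y c b = if a = b then 1 else 0 :=
    fun a b => h.inv_mul_gram hy a b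
  have step : pd j (fun z => (gram X z)⁻¹ i k) y =
      ∑ c, (∑ a, pd j (fun z => (gram X z)⁻¹ i a) y * gram X y a c) * (gram X y)⁻¹ c k := by
    simp only [Finset.sum_mul, mul_assoc]
    rw [Finset.sum_comm]
    simp only [← Finset.mul_sum, hr]
    simp
  rw [step]
  simp only [key, hpg]
  have l0 := hl i 0
  have l1 := hl i 1
  have r0 := hr 0 k
  have r1 := hr 1 k
  have s01 := gram_comm X y 0 1
  simp only [Fin.sum_univ_two] at *
  rw [s01] at *
  -- The free upper index is expanded in Kronecker deltas, which are then replaced by entries of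
  -- g⁻¹g and gg⁻¹; this turns the claim into a polynomial identity.
  have : ∀ m, christoffel (gram X) i j m y =
      (if i = 0 then 1 else 0) * christoffel (gram X) 0 j m y
      + (if i = 1 then 1 else 0) * christoffel (gram X) 1 j m y := by
    intro m; fin_cases i <;> simp
  rw [this 0, this 1]
  have : ∀ m, christoffel (gram X) k j m y =
      (if 0 = k then 1 else 0) * christoffel (gram X) 0 j m y
      + (if 1 = k then 1 else 0) * christoffel (gram X) 1 j m y := by
    intro m; fin_cases k <;> simp
  rw [this 0, this 1, ← l0, ← l1, ← r0, ← r1]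
  ring

/-- The trace of the Codazzi tensor is the normal derivative of the mean curvature vector. -/
lemma proj_pd_meanCoord (h : RegularPatch X U) (hy : y ∈ U) (j : Fin 2) :
    proj X y (pd j (meanCoord X) y) =
      (1 / 2 : ℝ) • ∑ i, ∑ k, (gram X y)⁻¹ i k • covDerivForm X j i k y := by
  have hterm : ∀ i k, ContDiffOn ℝ ∞ (fun z => (gram X z)⁻¹ i k • covHess (gram X) X i k z) U :=
    fun i k => (h.smooth_inv i k).smul (h.smooth_covHess i k)
  have e : pd j (meanCoord X) y = (1 / 2 : ℝ) • ∑ i, ∑ k,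
      (pd j (fun z => (gram X z)⁻¹ i k) y • covHess (gram X) X i k y +
        (gram X y)⁻¹ i k • pd j (covHess (gram X) X i k) y) := by
    unfold meanCoord
    rw [pd_const_smul _ (h.differentiableAt (ContDiffOn.sum fun i _ => ContDiffOn.sum
      fun k _ => hterm i k) hy), pd_sum _ fun i _ => h.differentiableAt (ContDiffOn.sum
      fun k _ => hterm i k) hy]
    congr 1
    refine Finset.sum_congr rfl fun i _ => ?_
    rw [pd_sum _ fun k _ => h.differentiableAt (hterm i k) hy]
    exact Finset.sum_congr rfl fun k _ => pd_smul (h.differentiableAt (h.smooth_inv i k) hy)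
      (h.differentiableAt (h.smooth_covHess i k) hy) j
  rw [e, proj_smul, proj_sum]
  congr 1
  simp only [proj_add, proj_smul, h.proj_covHess hy, h.proj_pd_covHess hy, h.pd_inv hy,
    Fin.sum_univ_two]
  module

/-- The Gauss equation. -/
lemma gaussCurvCoord_eq (h : RegularPatch X U) (hy : y ∈ U) :
    gaussCurvCoord (gram X) y =
      (mink (covHess (gram X) X 0 0 y) (covHess (gram X) X 1 1 y)
        - mink (covHess (gram X) X 0 1 y) (covHess (gram X) X 0 1 y)) / (gram X y).det := by
  have hd : ∀ l a b, DifferentiableAt ℝ (christoffel (gram X) l a b) y :=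
    fun l a b => h.differentiableAt (h.smooth_christoffel l a b) hy
  have hs : ∀ i j k, mink (pd i (covHess (gram X) X j k) y) (pd 0 X y) =
      -mink (covHess (gram X) X j k y) (covHess (gram X) X i 0 y) := fun i j k =>
    h.mink_pd_normal hy (h.smooth_covHess j k) (fun z hz l => h.mink_covHess_pd hz j k l) i 0
  have e0 := hs 0 1 1
  have e1 := hs 1 0 1
  -- Subtracting the two Weingarten relations eliminates the third derivatives; the Christoffel
  -- terms left over form the curvature tensor.
  have e : pd 0 (pd 1 (pd 1 X)) y = pd 1 (pd 0 (pd 1 X)) y :=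
    MinkowskiSurface.pd_comm h.isOpen (h.smooth_pd 1) hy 0 1
  rw [h.pd_covHess_eq hy] at e0 e1
  have c := fun i m => h.christoffel_mul_gram hy i m 0
  unfold gaussCurvCoord riemann
  congr 1
  simp only [Fin.sum_univ_two, mink_sub_left, mink_add_left, mink_smul_left, ← gram_apply,
    ← c] at *
  rw [e] at e0
  rw [h.covHess_comm hy 1 0, mink_comm (covHess (gram X) X 1 1 y)] at *
  linear_combination -e0 + e1

end RegularPatch

/-- The contraction of the normal curvature with a bilinear form:
`∑ gⁱʲ B(h(∂ᵢ, ∂₁), h(∂ⱼ, ∂₂))`. -/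
noncomputable def normalCurv (X : Plane → Minkowski) (B : Minkowski →ₗ[ℝ] Minkowski →ₗ[ℝ] ℝ)
    (y : Plane) : ℝ :=
  ∑ i, ∑ j, (gram X y)⁻¹ i j * B (covHess (gram X) X i 0 y) (covHess (gram X) X j 1 y)

/-- The component along `B` of the Gauss map of a patch. -/
noncomputable def gaussCoord (X : Plane → Minkowski) (B : Minkowski →ₗ[ℝ] Minkowski →ₗ[ℝ] ℝ)
    (y : Plane) : ℝ :=
  (√(gram X y).det)⁻¹ * B (pd 0 X y) (pd 1 X y)

/-- The Laplacian of a function in a coordinate patch. -/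
noncomputable def laplacianCoord (X : Plane → Minkowski) (φ : Plane → ℝ) (y : Plane) : ℝ :=
  -∑ i, ∑ j, (gram X y)⁻¹ i j * covHess (gram X) φ i j y

namespace RegularPatch

variable {X : Plane → Minkowski} {U : Set Plane} {y : Plane}

/-! #### The Laplacian of the Gauss map -/

lemma pd_det (h : RegularPatch X U) (hy : y ∈ U) (i : Fin 2) :
    pd i (fun z => (gram X z).det) y =
      2 * (∑ m, christoffel (gram X) m i m y) * (gram X y).det := by
  have hg : ∀ a b, DifferentiableAt ℝ (fun z => gram X z a b) y :=
    fun a b => h.differentiableAt (h.smooth_gram a b) hy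
  have e : (fun z => (gram X z).det) =
      fun z => gram X z 0 0 * gram X z 1 1 - gram X z 0 1 * gram X z 1 0 := by
    funext z; exact Matrix.det_fin_two _
  have c := fun i j l => h.christoffel_mul_gram hy i j l
  rw [e, pd_sub ((hg 0 0).fun_mul (hg 1 1)) ((hg 0 1).fun_mul (hg 1 0)), pd_mul (hg 0 0) (hg 1 1),
    pd_mul (hg 0 1) (hg 1 0)]
  simp only [h.pd_gram hy, mink_comm (pd _ X y) (pd _ (pd _ X) y), ← c, Matrix.det_fin_two,
    Fin.sum_univ_two, gram_comm X y 1 0]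
  ring

lemma smooth_inv_sqrt_det (h : RegularPatch X U) :
    ContDiffOn ℝ ∞ (fun z => (√(gram X z).det)⁻¹) U :=
  (h.smooth_det.sqrt fun _ hz => h.det_ne hz).inv
    fun z hz => (Real.sqrt_pos.mpr (h.det_pos z hz)).ne'

lemma pd_inv_sqrt_det (h : RegularPatch X U) (hy : y ∈ U) (i : Fin 2) :
    pd i (fun z => (√(gram X z).det)⁻¹) y =
      -(∑ m, christoffel (gram X) m i m y) * (√(gram X y).det)⁻¹ := by
  have hD := h.det_pos y hy
  have hs := Real.sqrt_pos.mpr hD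
  have hd := h.differentiableAt h.smooth_inv_sqrt_det hy
  have hdet := h.differentiableAt h.smooth_det hy
  -- Differentiating s² det g = 1 replaces an explicit derivative of the square root.
  have h1 : pd i (fun z => ((√(gram X z).det)⁻¹ * (√(gram X z).det)⁻¹) * (gram X z).det) y = 0 := by
    rw [pd_congr h.isOpen (ψ := fun _ => (1 : ℝ)) (fun z hz => ?_) hy, pd_const]
    have := Real.mul_self_sqrt (h.det_pos z hz).le
    have h2 := (Real.sqrt_pos.mpr (h.det_pos z hz)).ne'
    field_simp
    nlinarith
  rw [pd_mul (hd.fun_mul hd) hdet, pd_mul hd hd, h.pd_det hy] at h1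
  set s := (√(gram X y).det)⁻¹ with hsdef
  have hs0 : s ≠ 0 := (inv_pos.mpr hs).ne'
  have : (2 * s * (gram X y).det) * (pd i (fun z => (√(gram X z).det)⁻¹) y
      + (∑ m, christoffel (gram X) m i m y) * s) = 0 := by
    linear_combination h1
  have h3 := (mul_eq_zero.mp this).resolve_left (by positivity)
  linarith

variable (B : Minkowski →ₗ[ℝ] Minkowski →ₗ[ℝ] ℝ)

lemma smooth_gaussCoord (h : RegularPatch X U) : ContDiffOn ℝ ∞ (gaussCoord X B) U :=
  h.smooth_inv_sqrt_det.mul (contDiffOn_bilin B (h.smooth_pd 0) (h.smooth_pd 1))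

/-- The tangential parts of the second derivatives contribute the trace of the Christoffel symbols,
since `B` is alternating; the derivative of the normalizing factor cancels this trace. Only the
second fundamental form survives. -/
lemma pd_gaussCoord (h : RegularPatch X U) (hB : ∀ v, B v v = 0) (hy : y ∈ U) (i : Fin 2) :
    pd i (gaussCoord X B) y = (√(gram X y).det)⁻¹ *
      (B (covHess (gram X) X i 0 y) (pd 1 X y) + B (pd 0 X y) (covHess (gram X) X i 1 y)) := by
  unfold gaussCoord
  rw [pd_mul (h.differentiableAt h.smooth_inv_sqrt_det hy)
      (h.differentiableAt (contDiffOn_bilin B (h.smooth_pd 0) (h.smooth_pd 1)) hy),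
    h.pd_inv_sqrt_det hy, pd_bilin B (h.differentiableAt (h.smooth_pd 0) hy)
      (h.differentiableAt (h.smooth_pd 1) hy), pd_pd_eq, pd_pd_eq]
  simp only [Fin.sum_univ_two, map_add, map_smul, LinearMap.add_apply, LinearMap.smul_apply,
    smul_eq_mul, hB]
  ring

lemma covHess_gaussCoord (h : RegularPatch X U) (hB : ∀ v, B v v = 0) (hy : y ∈ U)
    (i j : Fin 2) :
    covHess (gram X) (gaussCoord X B) i j y = (√(gram X y).det)⁻¹ *
      (B (covDerivForm X i j 0 y) (pd 1 X y) + B (pd 0 X y) (covDerivForm X i j 1 y)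
      + B (covHess (gram X) X i 0 y) (covHess (gram X) X j 1 y)
      + B (covHess (gram X) X j 0 y) (covHess (gram X) X i 1 y)
      - (∑ k, ∑ l, (gram X y)⁻¹ l k *
        mink (covHess (gram X) X j k y) (covHess (gram X) X i l y))
        * B (pd 0 X y) (pd 1 X y)) := by
  have hh : ∀ a b, DifferentiableAt ℝ (covHess (gram X) X a b) y :=
    fun a b => h.differentiableAt (h.smooth_covHess a b) hy
  have hX : ∀ a, DifferentiableAt ℝ (pd a X) y := fun a => h.differentiableAt (h.smooth_pd a) hy
  have hB0 := contDiffOn_bilin B (h.smooth_covHess j 0) (h.smooth_pd 1)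
  have hB1 := contDiffOn_bilin B (h.smooth_pd 0) (h.smooth_covHess j 1)
  have e := pd_congr h.isOpen (fun z hz => h.pd_gaussCoord B hB hz j) hy i
  rw [covHess, e, pd_mul (h.differentiableAt h.smooth_inv_sqrt_det hy)
      (h.differentiableAt (hB0.add hB1) hy), pd_add (h.differentiableAt hB0 hy)
      (h.differentiableAt hB1 hy), pd_bilin B (hh j 0) (hX 1), pd_bilin B (hX 0) (hh j 1),
    h.pd_inv_sqrt_det hy, h.pd_covHess_decomp hy, h.pd_covHess_decomp hy, pd_pd_eq, pd_pd_eq]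
  have hskew : ∀ v w, B v w = -B w v := by
    intro v w
    have := hB (v + w)
    simp only [map_add, LinearMap.add_apply, hB] at this
    linarith
  simp only [h.pd_gaussCoord B hB hy, Fin.sum_univ_two, map_add, map_sub, map_smul,
    LinearMap.add_apply, LinearMap.sub_apply, LinearMap.smul_apply,
    smul_eq_mul, hB]
  rw [hskew (pd 1 X y) (covHess (gram X) X j 1 y)]
  rw [hskew (covHess (gram X) X j 0 y) (pd 0 X y)]
  ring

/-- The trace of `covHess_gaussCoord`: the derivatives of h trace to DH by Codazzi, the two products
of second fundamental forms give the normal bivector, and the Weingarten terms add up to ‖h‖². -/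
lemma laplacianCoord_gaussCoord (h : RegularPatch X U) (hB : ∀ v, B v v = 0) (hy : y ∈ U) :
    laplacianCoord X (gaussCoord X B) y = (√(gram X y).det)⁻¹ *
      ((4 * mink (meanCoord X y) (meanCoord X y) - 2 * gaussCurvCoord (gram X) y)
          * B (pd 0 X y) (pd 1 X y)
        - 2 * B (proj X y (pd 0 (meanCoord X) y)) (pd 1 X y)
        - 2 * B (pd 0 X y) (proj X y (pd 1 (meanCoord X) y)) - 2 * normalCurv X B y) := by
  have hD := h.det_ne hy
  -- The left side is ‖h‖²; the traced Gauss equation rewrites it through H and K.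
  have hS : ∑ i, ∑ j, (gram X y)⁻¹ i j * (∑ k, ∑ l, (gram X y)⁻¹ l k *
        mink (covHess (gram X) X j k y) (covHess (gram X) X i l y)) =
      4 * mink (meanCoord X y) (meanCoord X y) - 2 * gaussCurvCoord (gram X) y := by
    rw [h.gaussCurvCoord_eq hy]
    obtain ⟨e00, e01, e10, e11⟩ := inv_apply_two (gram X y)
    simp only [meanCoord, Fin.sum_univ_two, mink_smul_left, mink_smul_right, mink_add_left,
      mink_add_right, e00, e01, e10, e11, h.covHess_comm hy 1 0, gram_comm X y 1 0,
      mink_comm (covHess (gram X) X 1 1 y) (covHess (gram X) X 0 0 y),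
      mink_comm (covHess (gram X) X 0 1 y) (covHess (gram X) X 0 0 y),
      mink_comm (covHess (gram X) X 1 1 y) (covHess (gram X) X 0 1 y)]
    have := Matrix.det_fin_two (gram X y)
    rw [gram_comm X y 1 0] at this
    field_simp
    rw [this]
    ring
  rw [← hS, h.proj_pd_meanCoord hy, h.proj_pd_meanCoord hy]
  simp only [laplacianCoord, h.covHess_gaussCoord B hB hy, normalCurv, Fin.sum_univ_two, map_add,
    map_smul, LinearMap.add_apply, LinearMap.smul_apply, smul_eq_mul]
  -- Codazzi moves the traced derivative index into the form, so that the trace falls on h and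
  -- yields the derivative of H.
  have c010 := h.covDerivForm_comm_right hy 0 1 0
  have c100 := h.covDerivForm_comm hy 1 0 0
  have c110 := h.covDerivForm_comm_right hy 1 1 0
  have c101 := h.covDerivForm_comm hy 1 0 1
  rw [c110, c100, c101, c010, gram_inv_comm X y 1 0]
  ring

end RegularPatch

/-! ### Linear algebra of the tangent and normal planes -/

/-- The alternating form `(v, w) ↦ ⟨v, a⟩⟨w, b⟩ - ⟨v, b⟩⟨w, a⟩`. -/
def wedgeForm (a b : Minkowski) : Minkowski →ₗ[ℝ] Minkowski →ₗ[ℝ] ℝ :=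
  LinearMap.mk₂ ℝ (fun v w => mink v a * mink w b - mink v b * mink w a)
    (by intros; simp only [mink_add_left]; ring)
    (by intros; simp only [mink_smul_left, smul_eq_mul]; ring)
    (by intros; simp only [mink_add_left]; ring)
    (by intros; simp only [mink_smul_left, smul_eq_mul]; ring)

lemma wedgeForm_apply (a b v w : Minkowski) :
    wedgeForm a b v w = mink v a * mink w b - mink v b * mink w a := rfl

lemma wedgeForm_self (a b v : Minkowski) : wedgeForm a b v v = 0 := by
  rw [wedgeForm_apply]; ring

/-- In dimension four, a vector orthogonal to a space-like plane is a combination of two given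
vectors of the normal plane, the first of which is light-like and not orthogonal to the second. -/
lemma exists_normal_combination {e₀ e₁ n l : Minkowski}
    (hdet : mink e₀ e₀ * mink e₁ e₁ - mink e₀ e₁ * mink e₀ e₁ ≠ 0)
    (hn₀ : mink n e₀ = 0) (hn₁ : mink n e₁ = 0) (hl₀ : mink l e₀ = 0) (hl₁ : mink l e₁ = 0)
    (hn : mink n n = 0) (hnl : mink n l ≠ 0) {w : Minkowski} (hw₀ : mink w e₀ = 0)
    (hw₁ : mink w e₁ = 0) : ∃ a b : ℝ, w = a • n + b • l := by
  have hsolve : ∀ a b : ℝ, a * mink e₀ e₀ + b * mink e₀ e₁ = 0 →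
      a * mink e₀ e₁ + b * mink e₁ e₁ = 0 → a = 0 ∧ b = 0 := by
    intro a b h0 h1
    constructor
    · refine (mul_eq_zero.mp (?_ : a * (mink e₀ e₀ * mink e₁ e₁ - mink e₀ e₁ * mink e₀ e₁) = 0)
        ).resolve_right hdet
      linear_combination mink e₁ e₁ * h0 - mink e₀ e₁ * h1
    · refine (mul_eq_zero.mp (?_ : b * (mink e₀ e₀ * mink e₁ e₁ - mink e₀ e₁ * mink e₀ e₁) = 0)
        ).resolve_right hdet
      linear_combination mink e₀ e₀ * h1 - mink e₀ e₁ * h0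
  have hli : LinearIndependent ℝ ![e₀, e₁, n, l] := by
    rw [Fintype.linearIndependent_iff]
    intro g hg
    simp only [Fin.sum_univ_four, Matrix.cons_val] at hg
    -- Pairing a relation with `e₀` and `e₁` removes the tangential coefficients; pairing with `n`
    -- then isolates that of `l`, because `n` is null, and pairing with `l` gives the last one.
    have hp : ∀ u, g 0 * mink e₀ u + g 1 * mink e₁ u + g 2 * mink n u + g 3 * mink l u = 0 := by
      intro u
      have := congrArg (fun v => mink v u) hg
      simpa only [mink_add_left, mink_smul_left, mink_zero_left] using this
    have p0 := hp e₀
    have p1 := hp e₁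
    have p2 := hp n
    have p3 := hp l
    rw [hn₀, hl₀, mink_comm e₁ e₀] at p0
    rw [hn₁, hl₁] at p1
    rw [mink_comm e₀, hn₀, mink_comm e₁, hn₁, hn, mink_comm l n] at p2
    rw [mink_comm e₀, hl₀, mink_comm e₁, hl₁] at p3
    obtain ⟨z0, z1⟩ := hsolve (g 0) (g 1) (by linarith) (by linarith)
    have z3 : g 3 = 0 := by
      have : g 3 * mink n l = 0 := by linarith
      exact (mul_eq_zero.mp this).resolve_right hnl
    have z2 : g 2 = 0 := by
      rw [z3] at p3
      have : g 2 * mink n l = 0 := by linarith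
      exact (mul_eq_zero.mp this).resolve_right hnl
    intro i
    fin_cases i <;> assumption
  have hspan := hli.span_eq_top_of_card_eq_finrank (by simp)
  have hmem : w ∈ Submodule.span ℝ (Set.range ![e₀, e₁, n, l]) := by rw [hspan]; trivial
  obtain ⟨c, hc⟩ := (Submodule.mem_span_range_iff_exists_fun ℝ).mp hmem
  simp only [Fin.sum_univ_four, Matrix.cons_val] at hc
  have q0 := congrArg (fun v => mink v e₀) hc
  have q1 := congrArg (fun v => mink v e₁) hc
  simp only [mink_add_left, mink_smul_left, hn₀, hl₀, hn₁, hl₁, hw₀, hw₁, mink_comm e₁ e₀]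
    at q0 q1
  obtain ⟨z0, z1⟩ := hsolve (c 0) (c 1) (by linarith) (by linarith)
  refine ⟨c 2, c 3, ?_⟩
  rw [← hc, z0, z1]
  simp

/-! ### Patches with null mean curvature vector -/

namespace RegularPatch

variable {X : Plane → Minkowski} {U : Set Plane} {y : Plane}

lemma mink_meanCoord_pd (h : RegularPatch X U) (hy : y ∈ U) (l : Fin 2) :
    mink (meanCoord X y) (pd l X y) = 0 := by
  simp only [meanCoord, mink_smul_left, mink_sum_left, h.mink_covHess_pd hy]
  simp

lemma mink_proj_right {v : Minkowski}
    (hv : ∀ k, mink v (pd k X y) = 0) (w : Minkowski) : mink v (proj X y w) = mink v w := by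
  conv_rhs => rw [eq_proj_add (X := X) (y := y) w]
  simp [Fin.sum_univ_two, mink_add_right, mink_smul_right, hv]

lemma gram_mul_eq_zero (hD : (gram X y).det ≠ 0) {c : Fin 2 → ℝ}
    (hc : ∀ l, ∑ k, c k * gram X y k l = 0) : c = 0 := by
  have h0 := hc 0
  have h1 := hc 1
  rw [Matrix.det_fin_two] at hD
  simp only [Fin.sum_univ_two] at h0 h1
  ext k
  refine (mul_eq_zero.mp (?_ : c k * (gram X y 0 0 * gram X y 1 1 - gram X y 0 1 * gram X y 1 0) = 0)
    ).resolve_right hD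
  fin_cases k <;> simp only [Fin.zero_eta, Fin.mk_one]
  · linear_combination gram X y 1 1 * h0 - gram X y 1 0 * h1
  · linear_combination gram X y 0 0 * h1 - gram X y 0 1 * h0

lemma wedgeForm_pd_pd (X : Plane → Minkowski) (y : Plane) :
    wedgeForm (pd 0 X y) (pd 1 X y) (pd 0 X y) (pd 1 X y) = (gram X y).det := by
  simp only [wedgeForm_apply, Matrix.det_fin_two, gram_apply]

/-- If the Laplacian of the Gauss map is a multiple of the Gauss map and the mean curvature vector
is null, then the mean curvature vector is parallel, and the factor is `-2K`. -/
lemma parallel_of_laplacianCoord (h : RegularPatch X U) (hy : y ∈ U)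
    (hnull : mink (meanCoord X y) (meanCoord X y) = 0) {c : ℝ}
    (hc : ∀ B : Minkowski →ₗ[ℝ] Minkowski →ₗ[ℝ] ℝ, (∀ v, B v v = 0) →
      laplacianCoord X (gaussCoord X B) y = c * gaussCoord X B y) :
    (∀ i, proj X y (pd i (meanCoord X) y) = 0) ∧ c = -2 * gaussCurvCoord (gram X) y := by
  have hs : (√(gram X y).det)⁻¹ ≠ 0 := (inv_pos.mpr (Real.sqrt_pos.mpr (h.det_pos y hy))).ne'
  have hN : ∀ i l, mink (proj X y (pd i (meanCoord X) y)) (pd l X y) = 0 :=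
    fun i l => h.mink_proj_pd hy _ l
  have hh : ∀ i j l, mink (covHess (gram X) X i j y) (pd l X y) = 0 :=
    fun i j l => h.mink_covHess_pd hy i j l
  have hE : ∀ B : Minkowski →ₗ[ℝ] Minkowski →ₗ[ℝ] ℝ, (∀ v, B v v = 0) →
      c * B (pd 0 X y) (pd 1 X y) = -2 * gaussCurvCoord (gram X) y * B (pd 0 X y) (pd 1 X y)
        - 2 * B (proj X y (pd 0 (meanCoord X) y)) (pd 1 X y)
        - 2 * B (pd 0 X y) (proj X y (pd 1 (meanCoord X) y)) - 2 * normalCurv X B y := by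
    intro B hB
    have := hc B hB
    rw [h.laplacianCoord_gaussCoord B hB hy, hnull, gaussCoord] at this
    refine mul_left_cancel₀ hs ?_
    linear_combination -this
  constructor
  · have hzero : ∀ b, (∀ k, mink b (pd k X y) = 0) → ∀ i,
        mink (proj X y (pd i (meanCoord X) y)) b = 0 := by
      intro b hb
      have hb' : ∀ k, mink (pd k X y) b = 0 := fun k => by rw [mink_comm, hb]
      -- Testing against `wedgeForm (pd l X y) b` with `b` normal kills the purely tangential and
      -- purely normal bivectors. The mixed part becomes a linear system with the Gram matrix, in
      -- which the pairing of `b` with D₁H goes with ∂₀ and that with D₀H goes, with a minus sign,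
      -- with ∂₁.
      have key := gram_mul_eq_zero (h.det_ne hy)
        (c := ![mink (proj X y (pd 1 (meanCoord X) y)) b,
          -mink (proj X y (pd 0 (meanCoord X) y)) b]) (by
        intro l
        have := hE (wedgeForm (pd l X y) b) (wedgeForm_self _ _)
        simp only [wedgeForm_apply, normalCurv, hb', hN, hh, ← gram_apply] at this
        simp only [Fin.sum_univ_two, Matrix.cons_val_zero, Matrix.cons_val_one]
        simp at this
        linarith)
      have k0 := congrFun key 0
      have k1 := congrFun key 1
      simp at k0 k1
      intro i
      fin_cases i
      · exact k1
      · exact k0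
    intro i
    refine eq_zero_of_forall_mink_eq_zero fun w => ?_
    rw [← mink_proj_right (hN i) w]
    exact hzero _ (h.mink_proj_pd hy w) i
  -- This tangential test form sees only the coefficient of ν.
  · have := hE (wedgeForm (pd 0 X y) (pd 1 X y)) (wedgeForm_self _ _)
    rw [wedgeForm_pd_pd] at this
    simp only [wedgeForm_apply, normalCurv, hN, hh] at this
    refine mul_right_cancel₀ (h.det_ne hy) ?_
    simpa using this

/-- The Ricci equation for a parallel mean curvature vector: the mean curvature vector has
vanishing normal curvature. -/
lemma ricci_meanCoord (h : RegularPatch X U)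
    (hpar : ∀ z ∈ U, ∀ i, proj X z (pd i (meanCoord X) z) = 0) (hy : y ∈ U) :
    ∑ l, ∑ m, ((gram X y)⁻¹ l m * mink (meanCoord X y) (covHess (gram X) X 0 l y)) •
        covHess (gram X) X 1 m y =
      ∑ l, ∑ m, ((gram X y)⁻¹ l m * mink (meanCoord X y) (covHess (gram X) X 1 l y)) •
        covHess (gram X) X 0 m y := by
  have hα : ∀ i l m, ContDiffOn ℝ ∞ (fun z => -((gram X z)⁻¹ l m *
      mink (meanCoord X z) (covHess (gram X) X i l z))) U := fun i l m =>
    ((h.smooth_inv l m).mul (smooth_mink h.smooth_meanCoord (h.smooth_covHess i l))).neg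
  have hterm : ∀ i l m, ContDiffOn ℝ ∞ (fun z => -((gram X z)⁻¹ l m *
      mink (meanCoord X z) (covHess (gram X) X i l z)) • pd m X z) U := fun i l m =>
    (hα i l m).smul (h.smooth_pd m)
  -- As DH = 0 on the whole patch, the derivative of H is tangential, given by the shape operator of
  -- H.
  have hW : ∀ i, Set.EqOn (pd i (meanCoord X)) (fun z => ∑ l, ∑ m, -((gram X z)⁻¹ l m *
      mink (meanCoord X z) (covHess (gram X) X i l z)) • pd m X z) U := by
    intro i z hz
    rw [eq_proj_add (X := X) (y := z) (pd i (meanCoord X) z), hpar z hz i, zero_add]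
    simp only [h.mink_pd_normal hz h.smooth_meanCoord (fun z hz l => h.mink_meanCoord_pd hz l),
      mul_neg]
  -- Derivatives of the shape operator coefficients multiply tangent vectors and are projected away;
  -- symmetry of the second derivatives of H then gives the identity.
  have hP : ∀ j i, proj X y (pd j (pd i (meanCoord X)) y) = -∑ l, ∑ m, ((gram X y)⁻¹ l m *
      mink (meanCoord X y) (covHess (gram X) X i l y)) • covHess (gram X) X j m y := by
    intro j i
    rw [pd_congr h.isOpen (hW i) hy, pd_sum _ fun l _ => h.differentiableAt
      (ContDiffOn.sum fun m _ => hterm i l m) hy, proj_sum, ← Finset.sum_neg_distrib]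
    refine Finset.sum_congr rfl fun l _ => ?_
    rw [pd_sum _ fun m _ => h.differentiableAt (hterm i l m) hy, proj_sum,
      ← Finset.sum_neg_distrib]
    refine Finset.sum_congr rfl fun m _ => ?_
    rw [pd_smul (h.differentiableAt (hα i l m) hy) (h.differentiableAt (h.smooth_pd m) hy),
      proj_add, proj_smul, proj_smul, h.proj_pd hy, h.proj_pd_pd hy]
    module
  have := hP 1 0
  rw [MinkowskiSurface.pd_comm h.isOpen h.smooth_meanCoord hy, hP 0 1] at this
  exact (neg_injective this).symm

/-- A marginally trapped patch with parallel mean curvature vector has flat normal bundle. -/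
lemma normalCurv_eq_zero (h : RegularPatch X U)
    (hpar : ∀ z ∈ U, ∀ i, proj X z (pd i (meanCoord X) z) = 0) (hy : y ∈ U)
    (hlight : IsLightlike (meanCoord X y)) (B : Minkowski →ₗ[ℝ] Minkowski →ₗ[ℝ] ℝ)
    (hB : ∀ v, B v v = 0) : normalCurv X B y = 0 := by
  obtain ⟨hne, hnull⟩ := hlight
  have hric := h.ricci_meanCoord hpar hy
  have hH := fun l => h.mink_meanCoord_pd hy l
  set n := meanCoord X y
  -- Since H ≠ 0, some vector pairs nontrivially with it; its normal part `l` completes `n = H` to a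
  -- basis of the normal plane.
  obtain ⟨w, hw⟩ : ∃ w, mink n w ≠ 0 := by
    by_contra! hcon
    exact hne (eq_zero_of_forall_mink_eq_zero hcon)
  have hL := h.mink_proj_pd hy w
  have hnl : mink n (proj X y w) ≠ 0 := by rwa [mink_proj_right hH]
  set l := proj X y w
  have hdet : mink (pd 0 X y) (pd 0 X y) * mink (pd 1 X y) (pd 1 X y)
      - mink (pd 0 X y) (pd 1 X y) * mink (pd 0 X y) (pd 1 X y) ≠ 0 := by
    have := h.det_ne hy
    rw [Matrix.det_fin_two, gram_comm X y 1 0] at this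
    exact this
  have hdec : ∀ i j, ∃ ab : ℝ × ℝ, covHess (gram X) X i j y = ab.1 • n + ab.2 • l := by
    intro i j
    obtain ⟨a, b, hab⟩ := exists_normal_combination hdet (hH 0) (hH 1) (hL 0) (hL 1) hnull hnl
      (h.mink_covHess_pd hy i j 0) (h.mink_covHess_pd hy i j 1)
    exact ⟨(a, b), hab⟩
  choose c hc using hdec
  have hskew : B l n = -B n l := by
    have := hB (n + l)
    simp only [map_add, LinearMap.add_apply, hB] at this
    linarith
  -- Write h = a n + b l. Pairing with `n` reads off b, and in the Ricci identity paired with `l`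
  -- the ⟨l,l⟩ terms cancel by symmetry. What is left is ⟨n,l⟩² times the coefficient of n ∧ l in
  -- the normal bivector, up to sign.
  have hpair := congrArg (fun v => mink v l) hric
  simp only [normalCurv, Fin.sum_univ_two, h.covHess_comm hy 1 0] at hpair ⊢
  simp only [hc, map_add, map_smul, LinearMap.add_apply,
    LinearMap.smul_apply, smul_eq_mul, hB, mink_add_left, mink_add_right, mink_smul_left,
    mink_smul_right, hnull, hskew, gram_inv_comm X y 1 0] at hpair ⊢
  refine mul_left_cancel₀ (mul_ne_zero hnl hnl) ?_
  linear_combination (-B n l) * hpair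

/-- The Laplacian of the Gauss map of a marginally trapped patch with parallel mean curvature. -/
lemma laplacianCoord_of_parallel (h : RegularPatch X U)
    (hpar : ∀ z ∈ U, ∀ i, proj X z (pd i (meanCoord X) z) = 0) (hy : y ∈ U)
    (hlight : IsLightlike (meanCoord X y)) (B : Minkowski →ₗ[ℝ] Minkowski →ₗ[ℝ] ℝ)
    (hB : ∀ v, B v v = 0) :
    laplacianCoord X (gaussCoord X B) y = -2 * gaussCurvCoord (gram X) y * gaussCoord X B y := by
  rw [h.laplacianCoord_gaussCoord B hB hy, h.normalCurv_eq_zero hpar hy hlight B hB, hpar y hy 0,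
    hpar y hy 1, hlight.2, gaussCoord]
  simp
  ring

end RegularPatch

/-! ### Alternating maps of two vectors -/

lemma update_zero_pair {V : Type*} (u v w : V) : Function.update ![u, w] 0 v = ![v, w] := by
  ext i; fin_cases i <;> rfl

lemma update_one_pair {V : Type*} (u v w : V) : Function.update ![v, u] 1 w = ![v, w] := by
  ext i; fin_cases i <;> rfl

/-- The bilinear map of an alternating map of two vectors. -/
def bilinOfAlternating {W : Type*} [AddCommGroup W] [Module ℝ W]
    (A : Minkowski [⋀^Fin 2]→ₗ[ℝ] W) : Minkowski →ₗ[ℝ] Minkowski →ₗ[ℝ] W :=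
  LinearMap.mk₂ ℝ (fun v w => A ![v, w])
    (fun v v' w => by simpa only [update_zero_pair] using A.map_update_add ![0, w] 0 v v')
    (fun c v w => by simpa only [update_zero_pair] using A.map_update_smul ![0, w] 0 c v)
    (fun v w w' => by simpa only [update_one_pair] using A.map_update_add ![v, 0] 1 w w')
    (fun c v w => by simpa only [update_one_pair] using A.map_update_smul ![v, 0] 1 c w)

lemma bilinOfAlternating_apply {W : Type*} [AddCommGroup W] [Module ℝ W]
    (A : Minkowski [⋀^Fin 2]→ₗ[ℝ] W) (v w : Minkowski) :
    bilinOfAlternating A v w = A ![v, w] := rfl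

lemma bilinOfAlternating_self {W : Type*} [AddCommGroup W] [Module ℝ W]
    (A : Minkowski [⋀^Fin 2]→ₗ[ℝ] W) (v : Minkowski) : bilinOfAlternating A v v = 0 :=
  A.map_eq_zero_of_eq ![v, v] (i := 0) (j := 1) rfl (by simp)

/-- Every alternating bilinear form comes from an alternating map. -/
def alternatingOfBilin (B : Minkowski →ₗ[ℝ] Minkowski →ₗ[ℝ] ℝ) (hB : ∀ v, B v v = 0) :
    Minkowski [⋀^Fin 2]→ₗ[ℝ] ℝ where
  toFun v := B (v 0) (v 1)
  map_update_add' v i x y := by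
    fin_cases i <;> simp [Function.update]
  map_update_smul' v i c x := by
    fin_cases i <;> simp [Function.update]
  map_eq_zero_of_eq' v i j h hij := by
    fin_cases i <;> fin_cases j <;> simp_all

/-! ### Change of coordinates -/

/-- The transposed Jacobian matrix `∂ᵢτᵃ`. -/
noncomputable def jac (τ : Plane → Plane) (z : Plane) : Matrix (Fin 2) (Fin 2) ℝ :=
  Matrix.of fun i a => pd i τ z a

/-- The patch `X` is a reparametrization `Y ∘ τ` of the patch `Y`. -/
structure Reparam (X : Plane → Minkowski) (U : Set Plane) (Y : Plane → Minkowski) (V : Set Plane)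
    (τ : Plane → Plane) : Prop where
  source : RegularPatch X U
  target : RegularPatch Y V
  smooth : ContDiffOn ℝ ∞ τ U
  mapsTo : Set.MapsTo τ U V
  eqOn : ∀ z ∈ U, X z = Y (τ z)

namespace Reparam

variable {X Y : Plane → Minkowski} {U V : Set Plane} {τ : Plane → Plane} {z : Plane}

lemma smooth_jac (h : Reparam X U Y V τ) (i a : Fin 2) :
    ContDiffOn ℝ ∞ (fun z => jac τ z i a) U :=
  (EuclideanSpace.proj (𝕜 := ℝ) a).contDiff.comp_contDiffOn
    (contDiffOn_pd h.source.isOpen h.smooth i)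

lemma pd_comp {F : Type*} [NormedAddCommGroup F] [NormedSpace ℝ F] (h : Reparam X U Y V τ)
    {φ : Plane → F} (hφ : ContDiffOn ℝ ∞ φ V) (hz : z ∈ U) (i : Fin 2) :
    pd i (fun z => φ (τ z)) z = ∑ a, jac τ z i a • pd a φ (τ z) :=
  MinkowskiSurface.pd_comp (h.target.differentiableAt hφ (h.mapsTo hz))
    (h.source.differentiableAt h.smooth hz) i

lemma pd_eq (h : Reparam X U Y V τ) (hz : z ∈ U) (i : Fin 2) :
    pd i X z = ∑ a, jac τ z i a • pd a Y (τ z) := by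
  rw [pd_congr h.source.isOpen h.eqOn hz, h.pd_comp h.target.smooth hz]

lemma pd_pd_eq (h : Reparam X U Y V τ) (hz : z ∈ U) (i j : Fin 2) :
    pd i (pd j X) z = ∑ a, (pd i (fun z => jac τ z j a) z • pd a Y (τ z) +
      jac τ z j a • ∑ b, jac τ z i b • pd b (pd a Y) (τ z)) := by
  have hJ : ∀ a, DifferentiableAt ℝ (fun z => jac τ z j a) z := fun a =>
    h.source.differentiableAt (h.smooth_jac j a) hz
  have hY : ∀ a, DifferentiableAt ℝ (fun z => pd a Y (τ z)) z := fun a =>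
    (h.target.differentiableAt (h.target.smooth_pd a) (h.mapsTo hz)).comp z
      (h.source.differentiableAt h.smooth hz)
  rw [pd_congr h.source.isOpen (fun z hz => h.pd_eq hz j) hz,
    pd_sum _ fun a _ => (hJ a).fun_smul (hY a)]
  refine Finset.sum_congr rfl fun a _ => ?_
  rw [pd_smul (hJ a) (hY a), h.pd_comp (h.target.smooth_pd a) hz]

lemma gram_eq (h : Reparam X U Y V τ) (hz : z ∈ U) :
    gram X z = jac τ z * gram Y (τ z) * (jac τ z).transpose := by
  ext i j
  simp only [gram_apply, h.pd_eq hz, Matrix.mul_apply, Matrix.transpose_apply, Fin.sum_univ_two,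
    mink_add_left, mink_add_right, mink_smul_left, mink_smul_right]
  ring

lemma det_gram (h : Reparam X U Y V τ) (hz : z ∈ U) :
    (gram X z).det = (jac τ z).det ^ 2 * (gram Y (τ z)).det := by
  rw [h.gram_eq hz, Matrix.det_mul, Matrix.det_mul, Matrix.det_transpose]
  ring

/-- The metric of the source patch would degenerate otherwise; no inverse of `τ` is needed. -/
lemma det_jac_ne (h : Reparam X U Y V τ) (hz : z ∈ U) : (jac τ z).det ≠ 0 := by
  intro h0
  refine h.source.det_ne hz ?_
  rw [h.det_gram hz, h0]
  simp

lemma eq_zero_of_jac_smul {E : Type*} [AddCommGroup E] [Module ℝ E] (h : Reparam X U Y V τ)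
    (hz : z ∈ U) {v : Fin 2 → E} (hv : ∀ i, ∑ a, jac τ z i a • v a = 0) (a : Fin 2) :
    v a = 0 := by
  have h0 := hv 0
  have h1 := hv 1
  have hJ := h.det_jac_ne hz
  rw [Matrix.det_fin_two] at hJ
  simp only [Fin.sum_univ_two] at h0 h1
  refine (smul_eq_zero.mp (?_ : (jac τ z 0 0 * jac τ z 1 1 - jac τ z 0 1 * jac τ z 1 0) • v a = 0)
    ).resolve_left hJ
  fin_cases a <;> simp only [Fin.zero_eta, Fin.mk_one]
  · linear_combination (norm := module) jac τ z 1 1 • h0 - jac τ z 0 1 • h1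
  · linear_combination (norm := module) jac τ z 0 0 • h1 - jac τ z 1 0 • h0

/-- The Jacobian is invertible, so both patches span the same tangent plane and have the same normal
projection. -/
lemma proj_eq (h : Reparam X U Y V τ) (hz : z ∈ U) (w : Minkowski) :
    proj X z w = proj Y (τ z) w := by
  have hn : ∀ a, mink (proj X z w) (pd a Y (τ z)) = 0 := by
    refine h.eq_zero_of_jac_smul hz fun i => ?_
    have := h.source.mink_proj_pd hz w i
    rw [h.pd_eq hz] at this
    simpa [Fin.sum_univ_two, mink_add_right, mink_smul_right] using this
  conv_rhs => rw [RegularPatch.eq_proj_add (X := X) (y := z) w]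
  have hY := fun a => h.target.proj_pd (h.mapsTo hz) a
  simp only [RegularPatch.proj_add, RegularPatch.proj_of_normal hn, RegularPatch.proj_sum,
    RegularPatch.proj_smul, h.pd_eq hz, hY]
  simp

/-- The second fundamental form is the normal part of the second derivative, and the second
derivatives of `τ` enter only tangentially. The transformation law of the Christoffel symbols is
thereby bypassed. -/
lemma covHess_eq (h : Reparam X U Y V τ) (hz : z ∈ U) (i j : Fin 2) :
    covHess (gram X) X i j z =
      ∑ a, ∑ b, (jac τ z j a * jac τ z i b) • covHess (gram Y) Y b a (τ z) := by
  have hY := fun a => h.target.proj_pd (h.mapsTo hz) a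
  rw [← h.source.proj_pd_pd hz, h.proj_eq hz, h.pd_pd_eq hz]
  simp only [RegularPatch.proj_add, RegularPatch.proj_sum, RegularPatch.proj_smul, hY,
    h.target.proj_pd_pd (h.mapsTo hz), Finset.smul_sum, smul_smul, smul_zero, zero_add]

lemma inv_gram (h : Reparam X U Y V τ) (hz : z ∈ U) :
    (gram Y (τ z))⁻¹ = (jac τ z).transpose * (gram X z)⁻¹ * jac τ z := by
  have hJ : IsUnit (jac τ z).det := isUnit_iff_ne_zero.mpr (h.det_jac_ne hz)
  have hJt : IsUnit (jac τ z).transpose.det := by rwa [Matrix.det_transpose]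
  rw [h.gram_eq hz, Matrix.mul_inv_rev, Matrix.mul_inv_rev, ← Matrix.mul_assoc,
    Matrix.mul_nonsing_inv _ hJt, Matrix.one_mul, Matrix.mul_assoc, Matrix.nonsing_inv_mul _ hJ,
    Matrix.mul_one]

lemma meanCoord_eq (h : Reparam X U Y V τ) (hz : z ∈ U) :
    meanCoord X z = meanCoord Y (τ z) := by
  simp only [meanCoord, h.covHess_eq hz, h.inv_gram hz, Matrix.mul_apply, Matrix.transpose_apply,
    Fin.sum_univ_two, h.target.covHess_comm (h.mapsTo hz) 1 0, gram_inv_comm X z 1 0]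
  module

/-- By the Gauss equation the curvature is a quotient whose numerator and denominator both scale by
the squared Jacobian determinant. -/
lemma gaussCurvCoord_eq (h : Reparam X U Y V τ) (hz : z ∈ U) :
    gaussCurvCoord (gram X) z = gaussCurvCoord (gram Y) (τ z) := by
  have hJ := h.det_jac_ne hz
  have hD := h.target.det_ne (h.mapsTo hz)
  rw [h.source.gaussCurvCoord_eq hz, h.target.gaussCurvCoord_eq (h.mapsTo hz), h.det_gram hz,
    div_eq_div_iff (mul_ne_zero (pow_ne_zero 2 hJ) hD) hD, Matrix.det_fin_two (jac τ z)]
  simp only [h.covHess_eq hz, Fin.sum_univ_two, mink_add_left, mink_add_right, mink_smul_left,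
    mink_smul_right, h.target.covHess_comm (h.mapsTo hz) 1 0,
    mink_comm (covHess (gram Y) Y 1 1 (τ z)) (covHess (gram Y) Y 0 0 (τ z)),
    mink_comm (covHess (gram Y) Y 0 1 (τ z)) (covHess (gram Y) Y 0 0 (τ z)),
    mink_comm (covHess (gram Y) Y 1 1 (τ z)) (covHess (gram Y) Y 0 1 (τ z))]
  ring

lemma parallel (h : Reparam X U Y V τ) (hz : z ∈ U)
    (hX : ∀ i, proj X z (pd i (meanCoord X) z) = 0) (a : Fin 2) :
    proj Y (τ z) (pd a (meanCoord Y) (τ z)) = 0 := by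
  refine h.eq_zero_of_jac_smul hz (v := fun a => proj Y (τ z) (pd a (meanCoord Y) (τ z)))
    (fun i => ?_) a
  have := hX i
  rw [pd_congr h.source.isOpen (fun z hz => h.meanCoord_eq hz) hz,
    h.pd_comp h.target.smooth_meanCoord hz, h.proj_eq hz, RegularPatch.proj_sum] at this
  simpa only [RegularPatch.proj_smul] using this

/-- The bivector scales by the Jacobian determinant and the area factor by its absolute value,
leaving its sign. -/
lemma gauss_eq {W : Type*} [AddCommGroup W] [Module ℝ W] (h : Reparam X U Y V τ) (hz : z ∈ U)
    (A : Minkowski [⋀^Fin 2]→ₗ[ℝ] W) :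
    (√(gram X z).det)⁻¹ • A ![pd 0 X z, pd 1 X z] =
      ((if 0 < (jac τ z).det then 1 else -1 : ℝ) * (√(gram Y (τ z)).det)⁻¹) •
        A ![pd 0 Y (τ z), pd 1 Y (τ z)] := by
  have hJ := h.det_jac_ne hz
  have hA : A ![pd 0 X z, pd 1 X z] = (jac τ z).det • A ![pd 0 Y (τ z), pd 1 Y (τ z)] := by
    have hskew := bilinOfAlternating_self A (pd 0 Y (τ z) + pd 1 Y (τ z))
    simp only [map_add, LinearMap.add_apply, bilinOfAlternating_self] at hskew
    simp only [← bilinOfAlternating_apply, h.pd_eq hz, Fin.sum_univ_two, map_add, map_smul,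
      LinearMap.add_apply, LinearMap.smul_apply, bilinOfAlternating_self, Matrix.det_fin_two]
    linear_combination (norm := module) (jac τ z 0 1 * jac τ z 1 0) • hskew
  rw [hA, h.det_gram hz, Real.sqrt_mul (sq_nonneg _), Real.sqrt_sq_eq_abs, smul_smul]
  congr 1
  rcases lt_or_gt_of_ne hJ with hlt | hgt
  · rw [if_neg hlt.not_gt, abs_of_neg hlt]
    field_simp
  · rw [if_pos hgt, abs_of_pos hgt]
    field_simp

end Reparam

section

variable {M : Type*} [TopologicalSpace M] [ChartedSpace Plane M]

/-! ### Surfaces in preferred charts -/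

lemma param_mem_target (p : M) : param p ∈ (extChartAt (𝓡 2) p).target :=
  mem_extChartAt_target p

lemma inChart_apply_extChartAt {F : Type*} (ψ : M → F) {p q : M}
    (hq : q ∈ (extChartAt (𝓡 2) p).source) : inChart ψ p (extChartAt (𝓡 2) p q) = ψ q := by
  simp only [inChart, Function.comp_apply, (extChartAt (𝓡 2) p).left_inv hq]

lemma target_mem_nhds (p : M) : (extChartAt (𝓡 2) p).target ∈ nhds (param p) :=
  (isOpen_extChartAt_target p).mem_nhds (param_mem_target p)

lemma IsSpacelikeImmersion.regularPatch [IsManifold (𝓡 2) ∞ M] {x : M → Minkowski}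
    (hx : IsSpacelikeImmersion x) (p : M) :
    RegularPatch (inChart x p) (extChartAt (𝓡 2) p).target where
  isOpen := isOpen_extChartAt_target p
  smooth := by
    rw [← contMDiffOn_iff_contDiffOn]
    exact hx.smooth.comp_contMDiffOn (contMDiffOn_extChartAt_symm p)
  det_pos := by
    intro y hy
    have : IsManifold (𝓡 2) 1 M := IsManifold.of_le (n := ∞) (by exact_mod_cast le_top)
    have hsymm : MDifferentiableAt 𝓘(ℝ, Plane) (𝓡 2) (extChartAt (𝓡 2) p).symm y := by
      have := mdifferentiableWithinAt_extChartAt_symm (I := 𝓡 2) hy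
      rwa [ModelWithCorners.range_eq_univ, mdifferentiableWithinAt_univ] at this
    have hinv := isInvertible_mfderivWithin_extChartAt_symm (I := 𝓡 2) hy
    rw [ModelWithCorners.range_eq_univ, mfderivWithin_univ] at hinv
    have hfd : ∀ v : Plane, fderiv ℝ (inChart x p) y v =
        mfderiv (𝓡 2) 𝓘(ℝ, Minkowski) x ((extChartAt (𝓡 2) p).symm y)
          (mfderiv 𝓘(ℝ, Plane) (𝓡 2) (extChartAt (𝓡 2) p).symm y v) := by
      intro v
      rw [← mfderiv_eq_fderiv]
      unfold inChart
      rw [mfderiv_comp y ((hx.smooth _).mdifferentiableAt (by simp)) hsymm]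
      rfl
    have hpos : ∀ v : Plane, v ≠ 0 →
        0 < mink (fderiv ℝ (inChart x p) y v) (fderiv ℝ (inChart x p) y v) := by
      intro v hv
      rw [hfd]
      refine hx.spacelike _ _ fun h0 => hv ?_
      exact hinv.injective (h0.trans (map_zero _).symm)
    have hq : ∀ a b : ℝ, (a ≠ 0 ∨ b ≠ 0) →
        0 < a ^ 2 * gram (inChart x p) y 0 0 + 2 * a * b * gram (inChart x p) y 0 1
          + b ^ 2 * gram (inChart x p) y 1 1 := by
      intro a b hab
      have := hpos (!₂[a, b]) (by
        intro h0
        have h1 := congrArg (fun v : Plane => v 0) h0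
        have h2 := congrArg (fun v : Plane => v 1) h0
        simp at h1 h2
        tauto)
      rw [fderiv_plane_apply] at this
      simp [Fin.sum_univ_two, mink_add_left, mink_add_right, mink_smul_left, mink_smul_right,
        ← gram_apply, gram_comm _ y 1 0] at this
      linarith
    have h0 := hq 1 0 (by simp)
    simp at h0
    -- The component of ∂₁ orthogonal to ∂₀, scaled by g₀₀; its square is g₀₀ det g.
    have h1 := hq (-gram (inChart x p) y 0 1) (gram (inChart x p) y 0 0) (Or.inr h0.ne')
    rw [Matrix.det_fin_two, gram_comm _ y 1 0]
    refine pos_of_mul_pos_right (b := _) (a := gram (inChart x p) y 0 0) ?_ h0.le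
    linarith

/-- The change of coordinates from the preferred chart at `q` to the preferred chart at `p`. -/
noncomputable def transition (p q : M) : Plane → Plane := extChartAt (𝓡 2) p ∘ (extChartAt (𝓡 2) q).symm

lemma transition_param (p q : M) : transition p q (param q) = extChartAt (𝓡 2) p q := by
  simp [transition, param]

lemma IsSpacelikeImmersion.reparam [IsManifold (𝓡 2) ∞ M] {x : M → Minkowski}
    (hx : IsSpacelikeImmersion x) (p q : M) :
    Reparam (inChart x q) ((extChartAt (𝓡 2) q).symm ≫ extChartAt (𝓡 2) p).source
      (inChart x p) (extChartAt (𝓡 2) p).target (transition p q) where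
  source := (hx.regularPatch q).mono
    ((continuousOn_extChartAt_symm q).isOpen_inter_preimage (isOpen_extChartAt_target q)
      (isOpen_extChartAt_source p)) Set.inter_subset_left
  target := hx.regularPatch p
  smooth := contDiffOn_ext_coord_change p q
  mapsTo := fun _ hz => (extChartAt (𝓡 2) p).map_source hz.2
  eqOn := fun _ hz => (inChart_apply_extChartAt x hz.2).symm

lemma param_mem_transition_source {p q : M} (hq : q ∈ (extChartAt (𝓡 2) p).source) :
    param q ∈ ((extChartAt (𝓡 2) q).symm ≫ extChartAt (𝓡 2) p).source :=
  ⟨param_mem_target q, by simpa [param] using hq⟩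

/-- At each nearby point the mean curvature is computed in that point's own chart; invariance under
the transition map brings all these values into one chart, where they can be differentiated. -/
lemma IsSpacelikeImmersion.inChart_meanCurvature [IsManifold (𝓡 2) ∞ M] {x : M → Minkowski}
    (hx : IsSpacelikeImmersion x) (p : M) :
    Set.EqOn (inChart (meanCurvature x) p) (meanCoord (inChart x p))
      (extChartAt (𝓡 2) p).target := by
  intro y hy
  have hq := (extChartAt (𝓡 2) p).map_target hy
  have := (hx.reparam p ((extChartAt (𝓡 2) p).symm y)).meanCoord_eq
    (param_mem_transition_source hq)
  rw [transition_param, (extChartAt (𝓡 2) p).right_inv hy] at this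
  exact this

lemma IsSpacelikeImmersion.inChart_gaussCurvature [IsManifold (𝓡 2) ∞ M] {x : M → Minkowski}
    (hx : IsSpacelikeImmersion x) (p : M) :
    Set.EqOn (inChart (gaussCurvature x) p) (gaussCurvCoord (gram (inChart x p)))
      (extChartAt (𝓡 2) p).target := by
  intro y hy
  have hq := (extChartAt (𝓡 2) p).map_target hy
  have := (hx.reparam p ((extChartAt (𝓡 2) p).symm y)).gaussCurvCoord_eq
    (param_mem_transition_source hq)
  rw [transition_param, (extChartAt (𝓡 2) p).right_inv hy] at this
  exact this

lemma contMDiffAt_of_inChart [IsManifold (𝓡 2) ∞ M] {F : Type*} [NormedAddCommGroup F]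
    [NormedSpace ℝ F] {ψ : M → F} {φ : Plane → F} {p : M}
    (hφ : ContDiffOn ℝ ∞ φ (extChartAt (𝓡 2) p).target)
    (h : Set.EqOn (inChart ψ p) φ (extChartAt (𝓡 2) p).target) :
    ContMDiffAt (𝓡 2) 𝓘(ℝ, F) ∞ ψ p := by
  have h0 : ContMDiffAt 𝓘(ℝ, Plane) 𝓘(ℝ, F) ∞ φ (extChartAt (𝓡 2) p p) :=
    (hφ.contDiffAt (target_mem_nhds p)).contMDiffAt
  have h1 : ContMDiffAt (𝓡 2) 𝓘(ℝ, F) ∞ (φ ∘ extChartAt (𝓡 2) p) p :=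
    h0.comp p contMDiffAt_extChartAt
  refine h1.congr_of_eventuallyEq ?_
  filter_upwards [extChartAt_source_mem_nhds (I := 𝓡 2) p] with q hq
  rw [← inChart_apply_extChartAt ψ hq, h ((extChartAt (𝓡 2) p).map_source hq)]
  rfl

lemma IsSpacelikeImmersion.contMDiff_gaussCurvature [IsManifold (𝓡 2) ∞ M] {x : M → Minkowski}
    (hx : IsSpacelikeImmersion x) : ContMDiff (𝓡 2) 𝓘(ℝ, ℝ) ∞ (gaussCurvature x) := by
  intro p
  have h := hx.regularPatch p
  refine contMDiffAt_of_inChart ?_ (hx.inChart_gaussCurvature p)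
  have hs := h.smooth_covHess
  exact (((RegularPatch.smooth_mink (hs 0 0) (hs 1 1)).sub
    (RegularPatch.smooth_mink (hs 0 1) (hs 0 1))).div h.smooth_det fun z hz => h.det_ne hz).congr
    fun z hz => h.gaussCurvCoord_eq hz

lemma IsSpacelikeImmersion.normalDeriv_eq [IsManifold (𝓡 2) ∞ M] {x : M → Minkowski}
    (hx : IsSpacelikeImmersion x) (p : M) (v : Plane) :
    normalDeriv x (meanCurvature x) p v =
      ∑ i, v i • proj (inChart x p) (param p) (pd i (meanCoord (inChart x p)) (param p)) := by
  have h := hx.regularPatch p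
  have hd : MDifferentiableAt (𝓡 2) 𝓘(ℝ, Minkowski) (meanCurvature x) p :=
    (contMDiffAt_of_inChart h.smooth_meanCoord (hx.inChart_meanCurvature p)).mdifferentiableAt
      (by simp)
  have e : mfderiv (𝓡 2) 𝓘(ℝ, Minkowski) (meanCurvature x) p v =
      ∑ i, v i • pd i (meanCoord (inChart x p)) (param p) := by
    rw [hd.mfderiv, ModelWithCorners.range_eq_univ, fderivWithin_univ]
    refine (fderiv_plane_apply (inChart (meanCurvature x) p) (param p) v).trans ?_
    exact Finset.sum_congr rfl fun i _ => by
      rw [pd_congr h.isOpen (hx.inChart_meanCurvature p) (param_mem_target p)]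
  simp only [← RegularPatch.proj_smul, ← RegularPatch.proj_sum]
  rw [← e]
  rfl

lemma IsSpacelikeImmersion.parallel_iff [IsManifold (𝓡 2) ∞ M] {x : M → Minkowski}
    (hx : IsSpacelikeImmersion x) :
    HasParallelMeanCurvature x ↔ ∀ (p : M) (i : Fin 2),
      proj (inChart x p) (param p) (pd i (meanCoord (inChart x p)) (param p)) = 0 := by
  constructor
  · intro h p i
    have := (hx.normalDeriv_eq p (EuclideanSpace.single i 1)).symm.trans (h p _)
    fin_cases i <;> simpa using this
  · intro h p v
    refine (hx.normalDeriv_eq p v).trans ?_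
    simp [h]

lemma IsSpacelikeImmersion.parallel_inChart [IsManifold (𝓡 2) ∞ M] {x : M → Minkowski}
    (hx : IsSpacelikeImmersion x) (hpar : HasParallelMeanCurvature x) (p : M) :
    ∀ y ∈ (extChartAt (𝓡 2) p).target, ∀ i,
      proj (inChart x p) y (pd i (meanCoord (inChart x p)) y) = 0 := by
  intro y hy i
  have hq := (extChartAt (𝓡 2) p).map_target hy
  have := (hx.reparam p ((extChartAt (𝓡 2) p).symm y)).parallel
    (param_mem_transition_source hq) (hx.parallel_iff.mp hpar _) i
  rwa [transition_param, (extChartAt (𝓡 2) p).right_inv hy] at this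

/-! ### The Gauss map in a chart -/

open Classical in
/-- The sign of the coordinate basis of the preferred chart with respect to the orientation. -/
noncomputable def orientSign [IsManifold (𝓡 2) ∞ M] (o : SurfaceOrientation M) (p : M) : ℝ :=
  if (coordBasis p).orientation = o.orient p then 1 else -1

lemma orientSign_ne_zero [IsManifold (𝓡 2) ∞ M] (o : SurfaceOrientation M) (p : M) :
    orientSign o p ≠ 0 := by
  unfold orientSign; split_ifs <;> norm_num

lemma trivializationAt_linearEquivAt_apply [IsManifold (𝓡 2) ∞ M] (p q : M)
    (hq : q ∈ (trivializationAt Plane (TangentSpace (𝓡 2)) p).baseSet)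
    (v : TangentSpace (𝓡 2) q) :
    (trivializationAt Plane (TangentSpace (𝓡 2)) p).linearEquivAt ℝ q hq v =
      fderiv ℝ (transition p q) (param q) v := by
  rw [Bundle.Trivialization.linearEquivAt_apply, TangentBundle.trivializationAt_apply,
    ModelWithCorners.range_eq_univ, fderivWithin_univ]
  rfl

open Classical in
-- The sign relative to the chart at `q`, corrected by the sign of the transition Jacobian, depends
-- only on the orientation at `q` read in the trivialization at `p`, which is locally constant.
lemma orientSign_mul [IsManifold (𝓡 2) ∞ M] (o : SurfaceOrientation M) (p q : M)
    (hq : q ∈ (trivializationAt Plane (TangentSpace (𝓡 2)) p).baseSet) :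
    orientSign o q * (if 0 < (jac (transition p q) (param q)).det then 1 else -1) =
      if (EuclideanSpace.basisFun (Fin 2) ℝ).toBasis.orientation = Orientation.map (Fin 2)
        ((trivializationAt Plane (TangentSpace (𝓡 2)) p).linearEquivAt ℝ q hq) (o.orient q)
      then 1 else -1 := by
  set T := (trivializationAt Plane (TangentSpace (𝓡 2)) p).linearEquivAt ℝ q hq with hT
  have hdet : (EuclideanSpace.basisFun (Fin 2) ℝ).toBasis.det ((coordBasis q).map T) =
      (jac (transition p q) (param q)).det := by
    rw [Module.Basis.det_apply, ← Matrix.det_transpose]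
    congr 1
    ext i a
    simp only [Matrix.transpose_apply, Module.Basis.toMatrix_apply, Module.Basis.map_apply, jac,
      Matrix.of_apply]
    have := trivializationAt_linearEquivAt_apply p q hq (EuclideanSpace.single i 1)
    rw [← hT] at this
    have hb : coordBasis q i = EuclideanSpace.single i (1 : ℝ) :=
      EuclideanSpace.basisFun_apply (Fin 2) ℝ i
    rw [hb, this]
    simp [pd]
  have hmap := (coordBasis q).orientation_map T
  have hiff := (EuclideanSpace.basisFun (Fin 2) ℝ).toBasis.orientation_eq_iff_det_pos
    ((coordBasis q).map T)
  rw [hdet] at hiff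
  rcases (coordBasis q).orientation_eq_or_eq_neg (o.orient q) with h | h
  · rw [orientSign, h, ← hmap, if_pos rfl, one_mul]
    simp only [hiff]
  · have hne : (coordBasis q).orientation ≠ o.orient q := by
      rw [h]; exact Module.Ray.ne_neg_self _
    rw [orientSign, if_neg hne, h, Orientation.map_neg, ← hmap]
    have := ((coordBasis q).map T).orientation_ne_iff_eq_neg
      (EuclideanSpace.basisFun (Fin 2) ℝ).toBasis.orientation
    have hiff2 : (EuclideanSpace.basisFun (Fin 2) ℝ).toBasis.orientation =
        -((coordBasis q).map T).orientation ↔ ¬ 0 < (jac (transition p q) (param q)).det := by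
      rw [← hiff, ← this]
    simp only [hiff2]
    split_ifs <;> norm_num

lemma jac_transition_self [IsManifold (𝓡 2) ∞ M] (p : M) :
    jac (transition p p) (param p) = 1 := by
  have : Set.EqOn (transition p p) id (extChartAt (𝓡 2) p).target :=
    fun y hy => (extChartAt (𝓡 2) p).right_inv hy
  ext i a
  rw [jac, Matrix.of_apply, pd_congr (isOpen_extChartAt_target p) this (param_mem_target p)]
  simp [pd, Matrix.one_apply, PiLp.single_apply, eq_comm]

lemma eventually_orientSign [IsManifold (𝓡 2) ∞ M] (o : SurfaceOrientation M) (p : M) :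
    ∀ᶠ q in nhds p, orientSign o q *
      (if 0 < (jac (transition p q) (param q)).det then 1 else -1) = orientSign o p := by
  have hp : p ∈ (trivializationAt Plane (TangentSpace (𝓡 2)) p).baseSet :=
    FiberBundle.mem_baseSet_trivializationAt' p
  have hopen := (trivializationAt Plane (TangentSpace (𝓡 2) (M := M)) p).open_baseSet.isOpenMap_subtype_val
    _ ((o.locallyConstant p).isOpen_fiber (Orientation.map (Fin 2)
      ((trivializationAt Plane (TangentSpace (𝓡 2)) p).linearEquivAt ℝ p hp) (o.orient p)))
  filter_upwards [hopen.mem_nhds ⟨⟨p, hp⟩, rfl, rfl⟩] with q hq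
  obtain ⟨⟨q, hqb⟩, hq, rfl⟩ := hq
  have h1 := orientSign_mul o p q hqb
  have h2 := orientSign_mul o p p hp
  simp only [Set.mem_ofPred_eq] at hq
  rw [hq, ← h2, jac_transition_self, Matrix.det_one, if_pos one_pos, mul_one] at h1
  exact h1

lemma gaussMap_eq [IsManifold (𝓡 2) ∞ M] (x : M → Minkowski) (o : SurfaceOrientation M) (p : M) :
    gaussMap x o p = orientSign o p • (√(gram (inChart x p) (param p)).det)⁻¹ •
      exteriorPower.ιMulti ℝ 2
        ![pd 0 (inChart x p) (param p), pd 1 (inChart x p) (param p)] := by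
  rw [smul_smul, ← div_eq_mul_inv]
  rfl

/-- The Gauss map is smooth in the sense that it is given, near every point, by the coordinate
formula in one chart, with a constant sign. -/
lemma IsSpacelikeImmersion.eventually_gaussMap [IsManifold (𝓡 2) ∞ M] {x : M → Minkowski}
    (hx : IsSpacelikeImmersion x) (o : SurfaceOrientation M) (p : M) :
    ∀ᶠ q in nhds p, gaussMap x o q = orientSign o p •
      (√(gram (inChart x p) (extChartAt (𝓡 2) p q)).det)⁻¹ • exteriorPower.ιMulti ℝ 2
        ![pd 0 (inChart x p) (extChartAt (𝓡 2) p q),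
          pd 1 (inChart x p) (extChartAt (𝓡 2) p q)] := by
  filter_upwards [eventually_orientSign o p, extChartAt_source_mem_nhds (I := 𝓡 2) p] with q hq hqs
  have h := hx.reparam p q
  rw [gaussMap_eq, h.gauss_eq (param_mem_transition_source hqs) (exteriorPower.ιMulti ℝ 2),
    transition_param, ← hq]
  simp only [smul_smul, mul_assoc]

/-- The bilinear form of a linear functional on bivectors. -/
def dualBilin (ℓ : ⋀[ℝ]^2 Minkowski →ₗ[ℝ] ℝ) : Minkowski →ₗ[ℝ] Minkowski →ₗ[ℝ] ℝ :=
  bilinOfAlternating (ℓ.compAlternatingMap (exteriorPower.ιMulti ℝ 2))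

lemma dualBilin_apply (ℓ : ⋀[ℝ]^2 Minkowski →ₗ[ℝ] ℝ) (v w : Minkowski) :
    dualBilin ℓ v w = ℓ (exteriorPower.ιMulti ℝ 2 ![v, w]) := rfl

lemma dualBilin_self (ℓ : ⋀[ℝ]^2 Minkowski →ₗ[ℝ] ℝ) (v : Minkowski) : dualBilin ℓ v v = 0 :=
  bilinOfAlternating_self _ v

lemma dual_gaussMap [IsManifold (𝓡 2) ∞ M] (x : M → Minkowski) (o : SurfaceOrientation M) (p : M)
    (ℓ : ⋀[ℝ]^2 Minkowski →ₗ[ℝ] ℝ) : ℓ (gaussMap x o p) =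
      orientSign o p * gaussCoord (inChart x p) (dualBilin ℓ) (param p) := by
  rw [gaussMap_eq]
  simp only [map_smul, smul_eq_mul, gaussCoord, dualBilin_apply]

lemma laplacianCoord_congr (X : Plane → Minkowski) {φ ψ : Plane → ℝ} {y : Plane}
    (h : φ =ᶠ[nhds y] ψ) : laplacianCoord X φ y = laplacianCoord X ψ y := by
  simp only [laplacianCoord, covHess, fun i => (pd_eventuallyEq h i).eq_of_nhds,
    fun i j => (pd_eventuallyEq (pd_eventuallyEq h j) i).eq_of_nhds]

lemma RegularPatch.laplacianCoord_sum {X : Plane → Minkowski} {U : Set Plane} {y : Plane}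
    (h : RegularPatch X U) (hy : y ∈ U) {ι : Type*} (s : Finset ι) (c : ι → ℝ)
    {φ : ι → Plane → ℝ} (hφ : ∀ a, ContDiffOn ℝ ∞ (φ a) U) :
    laplacianCoord X (fun z => ∑ a ∈ s, c a * φ a z) y =
      ∑ a ∈ s, c a * laplacianCoord X (φ a) y := by
  have hpd : ∀ {ψ : ι → Plane → ℝ}, (∀ a, ContDiffOn ℝ ∞ (ψ a) U) → ∀ i, ∀ z ∈ U,
      pd i (fun z => ∑ a ∈ s, c a * ψ a z) z = ∑ a ∈ s, c a * pd i (ψ a) z := by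
    intro ψ hψ i z hz
    rw [pd_sum _ fun a _ => (h.differentiableAt (hψ a) hz).const_mul (c a)]
    exact Finset.sum_congr rfl fun a _ => pd_const_smul (c a) (h.differentiableAt (hψ a) hz) i
  have hpd2 : ∀ i j, pd i (pd j (fun z => ∑ a ∈ s, c a * φ a z)) y =
      ∑ a ∈ s, c a * pd i (pd j (φ a)) y := by
    intro i j
    rw [pd_congr h.isOpen (hpd hφ j) hy,
      hpd (fun a => contDiffOn_pd h.isOpen (hφ a) j) i y hy]
  simp only [laplacianCoord, covHess, hpd2, hpd hφ _ y hy, Fin.sum_univ_two, smul_eq_mul]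
  simp only [Finset.mul_sum, ← Finset.sum_add_distrib, ← Finset.sum_sub_distrib,
    ← Finset.sum_neg_distrib]
  exact Finset.sum_congr rfl fun a _ => by ring

/-- The Laplacian of the Gauss map, tested against a linear functional, is computed in a patch. -/
lemma IsSpacelikeImmersion.dual_vectorLaplacian [IsManifold (𝓡 2) ∞ M] {x : M → Minkowski}
    (hx : IsSpacelikeImmersion x) (o : SurfaceOrientation M) (p : M)
    (ℓ : ⋀[ℝ]^2 Minkowski →ₗ[ℝ] ℝ) :
    ℓ (vectorLaplacian x (gaussMap x o) p) = orientSign o p *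
      laplacianCoord (inChart x p) (gaussCoord (inChart x p) (dualBilin ℓ)) (param p) := by
  have h := hx.regularPatch p
  set b := Module.finBasis ℝ (⋀[ℝ]^2 Minkowski)
  have hcoord : ∀ a, laplacian x (fun q => b.repr (gaussMap x o q) a) p = orientSign o p *
      laplacianCoord (inChart x p) (gaussCoord (inChart x p) (dualBilin (b.coord a)))
        (param p) := by
    intro a
    have hev : inChart (fun q => b.repr (gaussMap x o q) a) p =ᶠ[nhds (param p)]
        -- A one-term sum, so that `laplacianCoord_sum` also handles the constant factor.
        fun z => ∑ _u ∈ ({()} : Finset Unit), orientSign o p *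
          gaussCoord (inChart x p) (dualBilin (b.coord a)) z := by
      have hc : Filter.Tendsto (extChartAt (𝓡 2) p).symm (nhds (param p)) (nhds p) := by
        have := continuousAt_extChartAt_symm (I := 𝓡 2) p
        rwa [ContinuousAt, extChartAt_to_inv] at this
      filter_upwards [hc.eventually (hx.eventually_gaussMap o p), target_mem_nhds p] with y hy hyt
      rw [(extChartAt (𝓡 2) p).right_inv hyt] at hy
      simp only [inChart, Function.comp_apply, hy, Finset.sum_singleton, gaussCoord,
        dualBilin_apply, Module.Basis.coord_apply, map_smul, Finsupp.smul_apply, smul_eq_mul]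
    refine (laplacianCoord_congr (inChart x p) hev).trans ?_
    rw [h.laplacianCoord_sum (param_mem_target p) _ _ fun _ => h.smooth_gaussCoord _]
    simp
  have hsum : gaussCoord (inChart x p) (dualBilin ℓ) = fun z => ∑ a, ℓ (b a) *
      gaussCoord (inChart x p) (dualBilin (b.coord a)) z := by
    funext z
    simp only [gaussCoord, dualBilin_apply]
    conv_lhs => rw [← b.sum_repr (exteriorPower.ιMulti ℝ 2
      ![pd 0 (inChart x p) z, pd 1 (inChart x p) z])]
    rw [map_sum, Finset.mul_sum]
    refine Finset.sum_congr rfl fun a _ => ?_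
    rw [map_smul, smul_eq_mul, Module.Basis.coord_apply]
    ring
  rw [hsum, h.laplacianCoord_sum (param_mem_target p) _ _ fun a => h.smooth_gaussCoord _,
    vectorLaplacian, map_sum, Finset.mul_sum]
  refine Finset.sum_congr rfl fun a _ => ?_
  rw [map_smul, hcoord, smul_eq_mul]
  ring

/-! ### Surfaces with pointwise 1-type Gauss map -/

lemma IsMarginallyTrapped.parallel_of_vectorLaplacian [IsManifold (𝓡 2) ∞ M] {x : M → Minkowski}
    (hx : IsMarginallyTrapped x) (o : SurfaceOrientation M) {f : M → ℝ}
    (hf : GaussMapEquation x o f 0) :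
    HasParallelMeanCurvature x ∧ ∀ p, f p = -2 * gaussCurvature x p := by
  have hx' := hx.toIsSpacelikeImmersion
  have key := fun p => (hx'.regularPatch p).parallel_of_laplacianCoord (param_mem_target p)
    (hx.lightlike p).2 (c := f p) (by
      intro B hB
      -- The universal property of Λ² makes every alternating form a functional on bivectors, so the
      -- vector equation may be tested on all of them.
      let ℓ := exteriorPower.alternatingMapLinearEquiv (alternatingOfBilin B hB)
      have hℓ : dualBilin ℓ = B := by
        refine LinearMap.ext₂ fun v w => ?_
        rw [dualBilin_apply, exteriorPower.alternatingMapLinearEquiv_apply_ιMulti]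
        rfl
      have := congrArg ℓ (hf p)
      rw [hx'.dual_vectorLaplacian, add_zero, map_smul, dual_gaussMap, hℓ, smul_eq_mul] at this
      refine mul_left_cancel₀ (orientSign_ne_zero o p) ?_
      linear_combination this)
  exact ⟨hx'.parallel_iff.mpr fun p => (key p).1, fun p => (key p).2⟩

lemma IsMarginallyTrapped.gaussMapEquation_of_parallel [IsManifold (𝓡 2) ∞ M]
    {x : M → Minkowski} (hx : IsMarginallyTrapped x) (o : SurfaceOrientation M)
    (hpar : HasParallelMeanCurvature x) :
    GaussMapEquation x o (fun p => -2 * gaussCurvature x p) 0 := by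
  have hx' := hx.toIsSpacelikeImmersion
  intro p
  refine (Module.finBasis ℝ (⋀[ℝ]^2 Minkowski)).ext_elem fun a => ?_
  rw [← Module.Basis.coord_apply, ← Module.Basis.coord_apply, hx'.dual_vectorLaplacian,
    (hx'.regularPatch p).laplacianCoord_of_parallel (hx'.parallel_inChart hpar p)
      (param_mem_target p) (hx.lightlike p) _ (dualBilin_self _), add_zero, map_smul,
    dual_gaussMap, smul_eq_mul]
  simp only [gaussCurvature]
  ring

end

end MinkowskiSurface

/-! ### The three equivalences -/

theorem mainTheorem9 {M : Type*} [TopologicalSpace M] [ChartedSpace MinkowskiSurface.Plane M]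
    [IsManifold (𝓡 2) ∞ M] (o : MinkowskiSurface.SurfaceOrientation M)
    (x : M → MinkowskiSurface.Minkowski) (hx : MinkowskiSurface.IsMarginallyTrapped x) :
    (MinkowskiSurface.HasPointwiseOneTypeFirstKind x o ↔
      MinkowskiSurface.HasParallelMeanCurvature x) ∧
    (MinkowskiSurface.HasStrictPointwiseOneTypeFirstKind x o ↔
      MinkowskiSurface.HasParallelMeanCurvature x ∧ ¬ MinkowskiSurface.IsFlat x) ∧
    (MinkowskiSurface.HasHarmonicGaussMap x o ↔
      MinkowskiSurface.IsFlat x ∧ MinkowskiSurface.HasParallelMeanCurvature x) := by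
  have hsmooth : ContMDiff (𝓡 2) 𝓘(ℝ, ℝ) ∞
      fun p => -2 * MinkowskiSurface.gaussCurvature x p :=
    contMDiff_const.mul hx.toIsSpacelikeImmersion.contMDiff_gaussCurvature
  refine ⟨⟨?_, ?_⟩, ⟨?_, ?_⟩, ⟨?_, ?_⟩⟩
  · rintro ⟨f, -, hf⟩
    exact (hx.parallel_of_vectorLaplacian o hf).1
  · intro hpar
    exact ⟨_, hsmooth, hx.gaussMapEquation_of_parallel o hpar⟩
  · rintro ⟨f, -, hne, hf⟩
    obtain ⟨hpar, hK⟩ := hx.parallel_of_vectorLaplacian o hf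
    refine ⟨hpar, fun hflat => hne ?_⟩
    funext p
    simp [hK p, hflat p]
  · rintro ⟨hpar, hflat⟩
    refine ⟨_, hsmooth, fun h0 => hflat fun p => ?_, hx.gaussMapEquation_of_parallel o hpar⟩
    simpa using congrFun h0 p
  · intro hharm
    obtain ⟨hpar, hK⟩ := hx.parallel_of_vectorLaplacian o (f := fun _ => 0) (fun p => by
      rw [hharm p, zero_smul])
    exact ⟨fun p => by simpa using (hK p).symm, hpar⟩
  · rintro ⟨hflat, hpar⟩ p
    refine (hx.gaussMapEquation_of_parallel o hpar p).trans ?_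
    simp [hflat p]
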